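/- Let $N,M\ge 0$ be integers and $L^2=L^2([0,1]^N,\mathbb C^M)$. For $1\le j\le N$ let $\langle f\rangle_j=\int_{[0,1]^j} f\,dk_1\cdots dk_j$, a function of $(k_{j+1},\dots,k_N)\in[0,1]^{N-j}$ (also regarded as a function on $[0,1]^N$ not depending on $k_1,\dots,k_j$). Let $\mathscr H$ be the smallest subalgebra of the algebra of bounded operators on $L^2$ which contains all operators of multiplication by continuous $M\times M$ matrix-valued functions on $[0,1]^N$ and the operators $\langle\cdot\rangle_1,\dots,\langle\cdot\rangle_N$, and let $\mathrm{Inv}(\mathscr H)$ be the set of its elements that are invertible operators on $L^2$. Let $\mathscr C=\mathscr C_0\times\dots\times\mathscr C_N$, where $\mathscr C_j$ is the algebra of continuous functions $[0,1]^{N-j}\to\mathbb C$ ($\mathscr C_N=\mathbb C$), and let $\mathrm{Inv}(\mathscr C)$ be the group of its invertible elements, i.e. of the tuples of nowhere vanishing continuous functions. Every $\mathcal A\in\mathscr H$ has a representation $$\mathcal A u=\mathbf A_0u+\mathbf A_1\langle \mathbf B_1u\rangle_1+\dots+\mathbf A_N\langle \mathbf B_Nu\rangle_N,\qquad u\in L^2,\tag{1}$$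 with continuous matrix-valued functions on $[0,1]^N$, where $\mathbf A_0$ is $M\times M$, $\mathbf A_j$ is $M\times M_j$ and $\mathbf B_j$ is $M_j\times M$ for some integers $M_j\ge1$. For $\mathcal A$ of the form (1) define successively (the scheme stops if some $\pi_j$ has a zero) $$\pi_0=\det\mathbf A_0,\qquad \mathbf A_{j,0}=\mathbf A_0^{-1}\mathbf A_j\quad(1\le j\le N),$$ and for $s=1,\dots,N$ $$\mathbf E_s=\mathbf I+\langle\mathbf B_s\mathbf A_{s,s-1}\rangle_s,\qquad \pi_s=\det\mathbf E_s,\qquad \mathbf A_{j,s}=\mathbf A_{j,s-1}-\mathbf A_{s,s-1}\mathbf E_s^{-1}\langle\mathbf B_s\mathbf A_{j,s-1}\rangle_s\quad(s<j\le N).$$ Then $\mathrm{Inv}(\mathscr H)$ is a group under composition (in particular $\mathcal A^{-1}\in\mathscr H$ for each $\mathcal A\in\mathrm{Inv}(\mathscr H)$). For $\mathcal A\in\mathrm{Inv}(\mathscr H)$ the scheme runs to the end, the functions $\pi_j$ are continuous and nowhere zero on $[0,1]^{N-j}$ and do not depend on the representation (1) of $\mathcal A$, and the mapping $$\boldsymbol\pi=(\pi_0,\dots,\pi_N):\mathrm{Inv}(\mathscr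 H)\to\mathrm{Inv}(\mathscr C)$$ is a group homomorphism. Moreover, let $\mathscr F_0$ be the set of invertible operators of multiplication by continuous $M\times M$ matrix-valued functions and, for $1\le j\le N$, let $\mathscr F_j$ be the set of invertible operators of the form $u\mapsto u+\mathbf A\langle\mathbf B u\rangle_j$ with continuous $\mathbf A$ ($M\times m$), $\mathbf B$ ($m\times M$), $m\ge1$. Then $\mathscr F_j\subset\mathrm{Inv}(\mathscr H)$ and $\boldsymbol\pi|_{\mathscr F_j}=(1,\dots,1,\pi_j,1,\dots,1)$, with $\pi_j$ in the $j$-th position, $j=0,\dots,N$. -/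

import Mathlib

open MeasureTheory
open scoped unitInterval ENNReal

namespace PeriodicOp

noncomputable section

/-- The cube `[0,1]^N`. -/
abbrev Cube (N : ℕ) : Type := Fin N → I

/-- The cube `[0,1]^j` of the first `j` variables `k_1, …, k_j`
(the variable `k_i` has index `i - 1` in `Fin N`). -/
abbrev Head (N j : ℕ) : Type := {i : Fin N // i.1 < j} → I

/-- The cube `[0,1]^(N-j)` of the last `N - j` variables `k_{j+1}, …, k_N`. -/
abbrev Tail (N j : ℕ) : Type := {i : Fin N // ¬ i.1 < j} → I

/-- The point of `[0,1]^N` with given first `j` and last `N - j` coordinates. -/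
def glue {N : ℕ} (j : ℕ) (x : Head N j) (y : Tail N j) : Cube N :=
  fun i => if h : i.1 < j then x ⟨i, h⟩ else y ⟨i, h⟩

/-- `k ↦ (k_{j+1}, …, k_N)`. -/
def tail {N : ℕ} (j : ℕ) (k : Cube N) : Tail N j := fun i => k i.1

/-- `⟨f⟩_j`, the integral of `f` over the first `j` variables, as a function of the others. -/
def avg {N : ℕ} {E : Type*} [NormedAddCommGroup E] [NormedSpace ℝ E] (j : ℕ)
    (f : Cube N → E) (y : Tail N j) : E :=
  ∫ x : Head N j, f (glue j x y)

/-- `⟨F⟩_j` for matrix-valued `F`, entry by entry. -/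
def avgMat {N : ℕ} {m n : Type*} (j : ℕ) (F : Cube N → Matrix m n ℂ) (y : Tail N j) :
    Matrix m n ℂ :=
  Matrix.of fun a b => avg j (fun k => F k a b) y

/-- The Hilbert space `L²([0,1]^N, ℂ^M)`. -/
abbrev L2 (N M : ℕ) : Type := Lp (EuclideanSpace ℂ (Fin M)) 2 (volume : Measure (Cube N))

/-- Continuous functions on `[0,1]^N` with values in the `p × q` matrices. -/
abbrev CMat (N p q : ℕ) : Type := C(Cube N, Matrix (Fin p) (Fin q) ℂ)

/-! ### Operators of multiplication by continuous matrix functions -/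

/-- `k ↦ A(k) u(k)`. -/
def mulFun {N p q : ℕ} (A : CMat N p q) (u : Cube N → EuclideanSpace ℂ (Fin q)) :
    Cube N → EuclideanSpace ℂ (Fin p) :=
  fun k => WithLp.toLp 2 ((A k).mulVec (u k).ofLp)

/-- The values of a continuous matrix function as continuous linear maps (auxiliary). -/
def toCLM {N p q : ℕ} (A : CMat N p q) (k : Cube N) :
    EuclideanSpace ℂ (Fin q) →L[ℂ] EuclideanSpace ℂ (Fin p) :=
  LinearMap.toContinuousLinearMap (Matrix.toEuclideanLin (A k))

theorem toCLM_apply {N p q : ℕ} (A : CMat N p q) (k : Cube N) (v : EuclideanSpace ℂ (Fin q)) :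
    toCLM A k v = WithLp.toLp 2 ((A k).mulVec v.ofLp) := rfl

theorem continuous_toCLM {N p q : ℕ} (A : CMat N p q) : Continuous (toCLM A) := by
  have h : Continuous ((LinearMap.toContinuousLinearMap :
      (EuclideanSpace ℂ (Fin q) →ₗ[ℂ] EuclideanSpace ℂ (Fin p)) ≃ₗ[ℂ] _).toLinearMap ∘ₗ
      (Matrix.toEuclideanLin (𝕜 := ℂ) (m := Fin p) (n := Fin q)).toLinearMap) :=
    LinearMap.continuous_of_finiteDimensional _
  exact h.comp A.continuous

theorem exists_bound_toCLM {N p q : ℕ} (A : CMat N p q) : ∃ C : ℝ, ∀ k, ‖toCLM A k‖ ≤ C := by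
  obtain ⟨C, hC⟩ := isCompact_univ.exists_bound_of_continuousOn (continuous_toCLM A).continuousOn
  exact ⟨C, fun k => hC k trivial⟩

theorem norm_mulFun_le {N p q : ℕ} (A : CMat N p q) (u : Cube N → EuclideanSpace ℂ (Fin q))
    (k : Cube N) : ‖mulFun A u k‖ ≤ (exists_bound_toCLM A).choose * ‖u k‖ :=
  (ContinuousLinearMap.le_opNorm (toCLM A k) (u k)).trans
    (mul_le_mul_of_nonneg_right ((exists_bound_toCLM A).choose_spec k) (norm_nonneg _))

theorem memLp_mulFun {N p q : ℕ} (A : CMat N p q) (u : L2 N q) :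
    MemLp (mulFun A u) 2 (volume : Measure (Cube N)) := by
  refine (Lp.memLp u).of_le_mul (c := (exists_bound_toCLM A).choose) ?_
    (Filter.Eventually.of_forall fun k => norm_mulFun_le A u k)
  have h1 : AEStronglyMeasurable (toCLM A) (volume : Measure (Cube N)) :=
    (continuous_toCLM A).aestronglyMeasurable
  have h2 := Lp.aestronglyMeasurable u
  exact isBoundedBilinearMap_apply.continuous.comp_aestronglyMeasurable (h1.prodMk h2)

/-- The operator `𝐀·` of multiplication by a continuous matrix function. -/
def mulOp {N p q : ℕ} (A : CMat N p q) : L2 N q →L[ℂ] L2 N p :=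
  LinearMap.mkContinuous
    { toFun := fun u => (memLp_mulFun A u).toLp _
      map_add' := by
        intro u v
        apply Lp.ext
        filter_upwards [MemLp.coeFn_toLp (memLp_mulFun A (u + v)),
          MemLp.coeFn_toLp (memLp_mulFun A u), MemLp.coeFn_toLp (memLp_mulFun A v),
          Lp.coeFn_add u v, Lp.coeFn_add ((memLp_mulFun A u).toLp _) ((memLp_mulFun A v).toLp _)]
          with k h1 h2 h3 h4 h5
        rw [h1, h5, Pi.add_apply, h2, h3]
        simp only [mulFun, h4, Pi.add_apply, WithLp.ofLp_add, Matrix.mulVec_add, WithLp.toLp_add]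
      map_smul' := by
        intro c u
        apply Lp.ext
        filter_upwards [MemLp.coeFn_toLp (memLp_mulFun A (c • u)),
          MemLp.coeFn_toLp (memLp_mulFun A u), Lp.coeFn_smul c u,
          Lp.coeFn_smul c ((memLp_mulFun A u).toLp _)]
          with k h1 h2 h3 h4
        rw [h1, RingHom.id_apply, h4, Pi.smul_apply, h2]
        simp only [mulFun, h3, Pi.smul_apply, WithLp.ofLp_smul, Matrix.mulVec_smul,
          WithLp.toLp_smul] }
    (exists_bound_toCLM A).choose (by
      intro u
      apply Lp.norm_le_mul_norm_of_ae_le_mul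
      filter_upwards [MemLp.coeFn_toLp (memLp_mulFun A u)] with k hk
      simp only [LinearMap.coe_mk, AddHom.coe_mk]
      rw [hk]
      exact norm_mulFun_le A u k)

theorem coeFn_mulOp {N p q : ℕ} (A : CMat N p q) (u : L2 N q) :
    mulOp A u =ᵐ[volume] fun k => WithLp.toLp 2 ((A k).mulVec (u k).ofLp) :=
  MemLp.coeFn_toLp (memLp_mulFun A u)

/-! ### The integral operators `⟨·⟩_j` -/

theorem measurePreserving_glue {N : ℕ} (j : ℕ) :
    MeasurePreserving (fun z : Head N j × Tail N j => glue j z.1 z.2) := by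
  exact (volume_preserving_piEquivPiSubtypeProd (fun _ : Fin N => I) (fun i => i.1 < j)).symm

theorem measurePreserving_tail {N : ℕ} (j : ℕ) :
    MeasurePreserving (tail j : Cube N → Tail N j) := by
  have h1 := volume_preserving_piEquivPiSubtypeProd (fun _ : Fin N => I) (fun i => i.1 < j)
  exact (measurePreserving_snd (μ := (volume : Measure (Head N j)))
    (ν := (volume : Measure (Tail N j)))).comp h1

section AvgLemmas

variable {N M : ℕ}

theorem memLp_glue (j : ℕ) (u : L2 N M) :
    MemLp (fun z : Head N j × Tail N j => u (glue j z.1 z.2)) 2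
      ((volume : Measure (Head N j)).prod (volume : Measure (Tail N j))) :=
  (Lp.memLp u).comp_measurePreserving (measurePreserving_glue j)

theorem ae_glue (j : ℕ) {P : Cube N → Prop} (h : ∀ᵐ k, P k) :
    ∀ᵐ y : Tail N j, ∀ᵐ x : Head N j, P (glue j x y) := by
  have h1 : ∀ᵐ z : Head N j × Tail N j, P (glue j z.1 z.2) :=
    (measurePreserving_glue j).quasiMeasurePreserving.ae h
  have h2 := (Measure.measurePreserving_swap (μ := (volume : Measure (Tail N j)))
    (ν := (volume : Measure (Head N j)))).quasiMeasurePreserving.ae h1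
  exact Measure.ae_ae_of_ae_prod h2

theorem integrable_glue (j : ℕ) (u : L2 N M) :
    ∀ᵐ y : Tail N j, Integrable (fun x : Head N j => u (glue j x y)) :=
  ((memLp_glue j u).integrable (by norm_num)).prod_left_ae

theorem aestronglyMeasurable_avg (j : ℕ) (u : L2 N M) :
    AEStronglyMeasurable (avg j u) (volume : Measure (Tail N j)) :=
  (memLp_glue j u).1.prod_swap.integral_prod_right'

theorem eLpNorm_avg_le (j : ℕ) (u : L2 N M) :
    eLpNorm (avg j u) 2 (volume : Measure (Tail N j)) ≤ eLpNorm u 2 volume := by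
  have hm := memLp_glue j u
  have hu : eLpNorm u 2 volume = eLpNorm (fun z : Head N j × Tail N j => u (glue j z.1 z.2)) 2
      ((volume : Measure (Head N j)).prod (volume : Measure (Tail N j))) :=
    (eLpNorm_comp_measurePreserving (Lp.aestronglyMeasurable u) (measurePreserving_glue j)).symm
  rw [hu, eLpNorm_eq_lintegral_rpow_enorm_toReal (by norm_num) (by norm_num),
    eLpNorm_eq_lintegral_rpow_enorm_toReal (by norm_num) (by norm_num)]
  refine ENNReal.rpow_le_rpow ?_ (by norm_num)
  rw [lintegral_prod_symm _ (hm.1.enorm.pow_const _)]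
  refine lintegral_mono_ae ?_
  have hae := hm.1.prod_swap.prodMk_left
  filter_upwards [hae] with y hy
  have h1 : ‖avg j u y‖ₑ ≤ eLpNorm (fun x : Head N j => u (glue j x y)) 1 volume := by
    rw [eLpNorm_one_eq_lintegral_enorm]
    exact enorm_integral_le_lintegral_enorm _
  have h2 := h1.trans (eLpNorm_le_eLpNorm_of_exponent_le (one_le_two : (1 : ℝ≥0∞) ≤ 2) hy)
  rw [eLpNorm_eq_lintegral_rpow_enorm_toReal (by norm_num) (by norm_num)] at h2
  have h3 := ENNReal.rpow_le_rpow h2 (by norm_num : (0 : ℝ) ≤ (2 : ℝ≥0∞).toReal)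
  rwa [← ENNReal.rpow_mul, one_div, inv_mul_cancel₀ (by norm_num), ENNReal.rpow_one] at h3

theorem memLp_avg (j : ℕ) (u : L2 N M) :
    MemLp (fun k : Cube N => avg j u (tail j k)) 2 volume := by
  have h : MemLp (avg j u) 2 (volume : Measure (Tail N j)) :=
    ⟨aestronglyMeasurable_avg j u, (eLpNorm_avg_le j u).trans_lt (Lp.memLp u).2⟩
  exact h.comp_measurePreserving (measurePreserving_tail j)

theorem eLpNorm_avg_tail_le (j : ℕ) (u : L2 N M) :
    eLpNorm (fun k : Cube N => avg j u (tail j k)) 2 volume ≤ eLpNorm u 2 volume :=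
  (eLpNorm_comp_measurePreserving (aestronglyMeasurable_avg j u)
    (measurePreserving_tail j)).trans_le (eLpNorm_avg_le j u)

theorem avg_add_ae (j : ℕ) (u v : L2 N M) :
    ∀ᵐ k : Cube N, avg j (u + v : L2 N M) (tail j k) = avg j u (tail j k) + avg j v (tail j k) := by
  refine (measurePreserving_tail j).quasiMeasurePreserving.ae
    (p := fun y => avg j (u + v : L2 N M) y = avg j u y + avg j v y) ?_
  filter_upwards [ae_glue j (Lp.coeFn_add u v), integrable_glue j u, integrable_glue j v]
    with y h hu hv
  exact (integral_congr_ae h).trans (integral_add hu hv)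

theorem avg_smul_ae (j : ℕ) (c : ℂ) (u : L2 N M) :
    ∀ᵐ k : Cube N, avg j (c • u : L2 N M) (tail j k) = c • avg j u (tail j k) := by
  refine (measurePreserving_tail j).quasiMeasurePreserving.ae
    (p := fun y => avg j (c • u : L2 N M) y = c • avg j u y) ?_
  filter_upwards [ae_glue j (Lp.coeFn_smul c u)] with y h
  exact (integral_congr_ae h).trans (integral_smul c _)

end AvgLemmas

/-- The operator `⟨·⟩_j` on `L²([0,1]^N, ℂ^M)`. -/
def avgOp {N M : ℕ} (j : ℕ) : L2 N M →L[ℂ] L2 N M :=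
  LinearMap.mkContinuous
    { toFun := fun u => (memLp_avg j u).toLp _
      map_add' := by
        intro u v
        apply Lp.ext
        filter_upwards [MemLp.coeFn_toLp (memLp_avg j (u + v)),
          MemLp.coeFn_toLp (memLp_avg j u), MemLp.coeFn_toLp (memLp_avg j v),
          avg_add_ae j u v, Lp.coeFn_add ((memLp_avg j u).toLp _) ((memLp_avg j v).toLp _)]
          with k h1 h2 h3 h4 h5
        rw [h1, h5, Pi.add_apply, h2, h3, h4]
      map_smul' := by
        intro c u
        apply Lp.ext
        filter_upwards [MemLp.coeFn_toLp (memLp_avg j (c • u)),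
          MemLp.coeFn_toLp (memLp_avg j u), avg_smul_ae j c u,
          Lp.coeFn_smul c ((memLp_avg j u).toLp _)]
          with k h1 h2 h3 h4
        rw [h1, RingHom.id_apply, h4, Pi.smul_apply, h2, h3] }
    1 (by
      intro u
      rw [one_mul]
      simp only [LinearMap.coe_mk, AddHom.coe_mk]
      rw [Lp.norm_toLp, Lp.norm_def]
      exact ENNReal.toReal_mono (Lp.eLpNorm_ne_top u) (eLpNorm_avg_tail_le j u))

theorem coeFn_avgOp {N M : ℕ} (j : ℕ) (u : L2 N M) :
    avgOp j u =ᵐ[volume] fun k => avg j u (tail j k) :=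
  MemLp.coeFn_toLp (memLp_avg j u)

/-! ### The algebra, its elements and the elimination scheme -/

/-- The algebra of periodic operators with parallel defects: the smallest subalgebra of the
bounded operators on `L²([0,1]^N, ℂ^M)` containing the multiplications by continuous `M × M`
matrix functions and `⟨·⟩_1, …, ⟨·⟩_N`. -/
def H (N M : ℕ) : Subalgebra ℂ (L2 N M →L[ℂ] L2 N M) :=
  Algebra.adjoin ℂ
    (Set.range (fun A : CMat N M M => mulOp A) ∪
      Set.range (fun r : Fin N => (avgOp (r.1 + 1) : L2 N M →L[ℂ] L2 N M)))

/-- The operator `𝐀⟨𝐁·⟩_j`, where `𝐀` is `M × m` and `𝐁` is `m × M`. -/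
def sandwich {N M m : ℕ} (j : ℕ) (A : CMat N M m) (B : CMat N m M) : L2 N M →L[ℂ] L2 N M :=
  mulOp A ∘L avgOp j ∘L mulOp B

/-- The data `𝐀_0, 𝐀_1, 𝐁_1, …, 𝐀_N, 𝐁_N` of an operator
`𝐀_0· + 𝐀_1⟨𝐁_1·⟩_1 + … + 𝐀_N⟨𝐁_N·⟩_N`; `𝐀_{r+1}`, `𝐁_{r+1}`, `M_{r+1}` are
`A r`, `B r`, `m r` with `r : Fin N`. -/
structure Rep (N M : ℕ) where
  m : Fin N → ℕ
  m_pos : ∀ r, 0 < m r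
  A₀ : CMat N M M
  A : (r : Fin N) → CMat N M (m r)
  B : (r : Fin N) → CMat N (m r) M

namespace Rep

variable {N M : ℕ}

/-- The operator with the given data. -/
def toOp (R : Rep N M) : L2 N M →L[ℂ] L2 N M :=
  mulOp R.A₀ + ∑ r : Fin N, sandwich (r.1 + 1) (R.A r) (R.B r)

/-- The matrix functions `𝐀_{j,s}` of the elimination scheme; `𝐀_{r+1,s}` is `R.elim s r`:
`𝐀_{j,0} = 𝐀_0⁻¹ 𝐀_j` and
`𝐀_{j,s} = 𝐀_{j,s-1} - 𝐀_{s,s-1} 𝐄_s⁻¹ ⟨𝐁_s 𝐀_{j,s-1}⟩_s`, `𝐄_s = 𝐈 + ⟨𝐁_s 𝐀_{s,s-1}⟩_s`. -/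
def elim (R : Rep N M) : ℕ → (r : Fin N) → Cube N → Matrix (Fin M) (Fin (R.m r)) ℂ
  | 0, r => fun k => (R.A₀ k)⁻¹ * R.A r k
  | s + 1, r =>
    if h : s < N then fun k =>
      elim R s r k - elim R s ⟨s, h⟩ k *
        (1 + avgMat (s + 1) (fun k' => R.B ⟨s, h⟩ k' * elim R s ⟨s, h⟩ k') (tail (s + 1) k))⁻¹ *
        avgMat (s + 1) (fun k' => R.B ⟨s, h⟩ k' * elim R s r k') (tail (s + 1) k)
    else elim R s r

/-- `𝐄_{r+1} = 𝐈 + ⟨𝐁_{r+1} 𝐀_{r+1,r}⟩_{r+1}`. -/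
def E (R : Rep N M) (r : Fin N) (y : Tail N (r.1 + 1)) : Matrix (Fin (R.m r)) (Fin (R.m r)) ℂ :=
  1 + avgMat (r.1 + 1) (fun k => R.B r k * R.elim r.1 r k) y

/-- The functions `π_0 = det 𝐀_0` and `π_j = det 𝐄_j`, `j = 1, …, N`. -/
def piFun (R : Rep N M) : (j : Fin (N + 1)) → Tail N j.1 → ℂ
  | ⟨0, _⟩ => fun y => (R.A₀ fun i => y ⟨i, Nat.not_lt_zero i.1⟩).det
  | ⟨r + 1, h⟩ => fun y => (R.E ⟨r, Nat.lt_of_succ_lt_succ h⟩ y).det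

end Rep

/-- The elementary sets `𝓕_0 = Inv {𝐀·}` and `𝓕_j = Inv {𝓘 + 𝐀⟨𝐁·⟩_j}`, `j ≥ 1`. -/
def F (N M : ℕ) (j : Fin (N + 1)) : Set (L2 N M →L[ℂ] L2 N M) :=
  {T | IsUnit T ∧
    ((j.1 = 0 ∧ ∃ A : CMat N M M, T = mulOp A) ∨
     (1 ≤ j.1 ∧ ∃ m : ℕ, 0 < m ∧ ∃ (A : CMat N M m) (B : CMat N m M),
        T = 1 + sandwich j.1 A B))}

/-- `𝓒 = 𝓒_0 × … × 𝓒_N`, where `𝓒_j` is the algebra of continuous functions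
`[0,1]^(N-j) → ℂ`. -/
abbrev CAlg (N : ℕ) : Type := (j : Fin (N + 1)) → C(Tail N j.1, ℂ)

end

end PeriodicOp

open Filter Topology

namespace PeriodicOp

noncomputable section

/-! ### Continuous matrix functions on the cube -/

/-! Write `T_s` for the part of an operator of the form (1) that keeps `𝐀_0` and the averages
`⟨·⟩_j` with `j ≤ s`. Everything rests on obtaining `T_s` from `T` alone. Conjugation by the
characters `exp (2πi n k_{s+1})` fixes multiplications and `⟨·⟩_j` for `j ≤ s`, while for `j > s`
the conjugates of `𝐀⟨𝐁·⟩_j` tend strongly to zero by Bessel's inequality. So `T_s` is a strong limit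
of conjugates of `T` (`Rep.isTrunc`). Hence it does not depend on the representation, `T ↦ T_s` is
multiplicative, and a lower bound `c‖u‖ ≤ ‖T u‖` passes to every `T_s`.

The scheme inverts `T_0, T_1, …, T_N` in turn (`Rep.exists_step`). If `V = T_s⁻¹`, then `V T_{s+1} =
𝓘 + 𝐂⟨𝐁·⟩_{s+1}` with `𝐂 = 𝐀_{s+1,s}`. This quotient is bounded below, so `𝐄 = 𝐈 + ⟨𝐁𝐂⟩_{s+1}` is
invertible at every point (`det_ne_zero_of_sandwich`), and the quotient has the explicit inverse `𝓘
- 𝐂𝐄⁻¹⟨𝐁·⟩_{s+1}`. The last inverse lies in the algebra, which is exactly the set of operators of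
the form (1).

The component `π_{s+1}` is the determinant of the quotient `T_s⁻¹T_{s+1}`. That determinant depends
only on the operator (`IsDet.unique`), is multiplicative (`IsDet.mul`), and is unchanged by
conjugation with invertible operators that involve only averages of lower order (`IsDet.conj`). The
quotient of `TT'` is the quotient of `T`, conjugated by `T'_s`, times the quotient of `T'`; so `π`
is multiplicative (`Rep.piFun_mul`). On `𝓕_j` the truncations change only on reaching `j`, so all
other quotients are the identity. -/

instance isOpenPosMeasure_unitInterval : (volume : Measure I).IsOpenPosMeasure := by
  refine ⟨fun U hU ⟨x, hx⟩ h0 => ?_⟩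
  -- A relatively open subset of `[0,1]` may contain an endpoint, so it is compared with the open
  -- set `V ∩ (0,1)` of the line, nonempty because `(0,1)` is dense in `[0,1]`.
  obtain ⟨V, hV, rfl⟩ := isOpen_induced_iff.1 hU
  have hcl : (x : ℝ) ∈ closure (Set.Ioo (0 : ℝ) 1) := by
    rw [closure_Ioo zero_ne_one]
    exact x.2
  have hne : (V ∩ Set.Ioo (0 : ℝ) 1).Nonempty := mem_closure_iff.1 hcl V hV hx
  have hpos : 0 < volume (V ∩ Set.Ioo (0 : ℝ) 1) := (hV.inter isOpen_Ioo).measure_pos volume hne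
  have hsub : V ∩ Set.Ioo (0 : ℝ) 1 ⊆ Subtype.val '' (Subtype.val ⁻¹' V : Set I) := by
    rintro t ⟨ht, h0, h1⟩
    exact ⟨⟨t, h0.le, h1.le⟩, ht, rfl⟩
  have him : volume (Subtype.val '' (Subtype.val ⁻¹' V : Set I)) = 0 := by
    rw [← h0]
    exact ((MeasurableEmbedding.subtype_coe measurableSet_Icc).comap_apply volume _).symm
  exact hpos.ne' (measure_mono_null hsub him)

instance isOpenPosMeasure_cube (N : ℕ) : (volume : Measure (Cube N)).IsOpenPosMeasure :=
  Measure.pi.isOpenPosMeasure _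

variable {N M p q r m m' : ℕ}

/-- The point with the first `j` coordinates of `k'` and the other coordinates of `k`. -/
def mix (j : ℕ) (k' k : Cube N) : Cube N := fun i => if i.1 < j then k' i else k i

/-- `k ↦ (k_1, …, k_j)`. -/
def head (j : ℕ) (k : Cube N) : Head N j := fun i => k i.1

theorem glue_head_tail (j : ℕ) (k' k : Cube N) : glue j (head j k') (tail j k) = mix j k' k := by
  funext i
  by_cases h : i.1 < j <;> simp [glue, head, tail, mix, h]

theorem tail_glue (j : ℕ) (x : Head N j) (y : Tail N j) : tail j (glue j x y) = y := by
  funext i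
  simp [glue, tail, i.2]

theorem tail_surjective (j : ℕ) : Function.Surjective (tail j : Cube N → Tail N j) :=
  fun y => ⟨glue j (fun _ => 0) y, tail_glue j _ y⟩

theorem tail_mix {i j : ℕ} (h : i ≤ j) (k' k : Cube N) : tail j (mix i k' k) = tail j k := by
  funext l
  have : ¬ l.1.1 < i := fun h' => l.2 (h'.trans_le h)
  simp [tail, mix, this]

theorem mix_mix {i j : ℕ} (h : j ≤ i) (k' k l : Cube N) :
    mix j k' (mix i k l) = mix i (mix j k' k) l := by
  funext a
  simp only [mix]
  split_ifs <;> first | rfl | omega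

theorem continuous_glue (j : ℕ) : Continuous fun z : Head N j × Tail N j => glue j z.1 z.2 := by
  refine continuous_pi fun i => ?_
  by_cases h : i.1 < j
  · simp only [glue, h, dif_pos]; fun_prop
  · simp only [glue, h, dif_neg, not_false_eq_true]; fun_prop

theorem continuous_tail (j : ℕ) : Continuous (tail j : Cube N → Tail N j) :=
  continuous_pi fun i => continuous_apply i.1

theorem continuous_mix (j : ℕ) : Continuous fun z : Cube N × Cube N => mix j z.1 z.2 := by
  refine continuous_pi fun i => ?_
  by_cases h : i.1 < j
  · simp only [mix, h, if_true]; fun_prop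
  · simp only [mix, h, if_false]; fun_prop

theorem measurePreserving_head (j : ℕ) : MeasurePreserving (head j : Cube N → Head N j) := by
  have h1 := volume_preserving_piEquivPiSubtypeProd (fun _ : Fin N => I) (fun i => i.1 < j)
  exact (measurePreserving_fst (μ := (volume : Measure (Head N j)))
    (ν := (volume : Measure (Tail N j)))).comp h1

theorem measurePreserving_mix (j : ℕ) :
    MeasurePreserving (fun z : Cube N × Cube N => mix j z.1 z.2) := by
  have h := (measurePreserving_glue (N := N) j).comp
    ((measurePreserving_head (N := N) j).prod (measurePreserving_tail (N := N) j))
  have e : ((fun z : Head N j × Tail N j => glue j z.1 z.2) ∘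
      Prod.map (head j : Cube N → _) (tail j : Cube N → _)) = fun z => mix j z.1 z.2 := by
    funext z
    exact glue_head_tail j z.1 z.2
  rw [← e]
  exact h

theorem Continuous.integrable_of_compact {X E : Type*} [TopologicalSpace X] [CompactSpace X]
    [MeasurableSpace X] [OpensMeasurableSpace X] [NormedAddCommGroup E]
    [SecondCountableTopologyEither X E] {μ : Measure X} [IsFiniteMeasure μ] {f : X → E}
    (hf : Continuous f) : Integrable f μ :=
  hf.integrable_of_hasCompactSupport (HasCompactSupport.of_compactSpace f)

/-- The superfluous variables of `k'` integrate out to `1`. Every average thus becomes an integral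
over the same cube, whatever `j` is, so that averages of different orders can be compared. -/
theorem avg_tail {E : Type*} [NormedAddCommGroup E] [NormedSpace ℝ E] (j : ℕ) {f : Cube N → E}
    (hf : Continuous f) (k : Cube N) : avg j f (tail j k) = ∫ k', f (mix j k' k) := by
  have h := measurePreserving_head (N := N) j
  rw [avg, ← h.map_eq, integral_map h.measurable.aemeasurable]
  · simp_rw [glue_head_tail]
  · exact (hf.comp ((continuous_glue j).comp
      (Continuous.prodMk_left (tail j k)))).aestronglyMeasurable

theorem continuous_avg {E : Type*} [NormedAddCommGroup E] [NormedSpace ℝ E] (j : ℕ)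
    {f : Cube N → E} (hf : Continuous f) : Continuous (avg j f) := by
  have h := continuous_parametric_integral_of_continuous
    (μ := (volume : Measure (Head N j))) (X := Tail N j)
    (f := fun y x => f (glue j x y))
    (hf.comp ((continuous_glue j).comp continuous_swap)) isCompact_univ
  simp only [setIntegral_univ] at h
  exact h

/-- `⟨F⟩_j` as a continuous function of the last variables. -/
def avgT (j : ℕ) (F : CMat N p q) : C(Tail N j, Matrix (Fin p) (Fin q) ℂ) :=
  ⟨avgMat j F, continuous_matrix fun a b => continuous_avg j (F.continuous.matrix_elem a b)⟩

/-- `⟨F⟩_j` as a continuous function on the whole cube. -/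
def avgC (j : ℕ) (F : CMat N p q) : CMat N p q :=
  ⟨fun k => avgT j F (tail j k), (avgT j F).continuous.comp (continuous_tail j)⟩

/-- The pointwise product of continuous matrix functions. -/
def cmul (A : CMat N p q) (B : CMat N q r) : CMat N p r :=
  ⟨fun k => A k * B k, A.continuous.matrix_mul B.continuous⟩

infixl:70 " ⊡ " => cmul

/-- The constant identity matrix. -/
def oneMat (p : ℕ) : CMat N p p := ContinuousMap.const _ 1

@[simp] theorem cmul_apply (A : CMat N p q) (B : CMat N q r) (k : Cube N) :
    (A ⊡ B) k = A k * B k := rfl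

@[simp] theorem oneMat_apply (k : Cube N) : (oneMat p : CMat N p p) k = 1 := rfl

theorem avgC_apply (j : ℕ) (F : CMat N p q) (k : Cube N) :
    avgC j F k = avgMat j F (tail j k) := rfl

theorem avgC_elem (j : ℕ) (F : CMat N p q) (k : Cube N) (a : Fin p) (b : Fin q) :
    avgC j F k a b = ∫ k', F (mix j k' k) a b :=
  avg_tail j (F.continuous.matrix_elem a b) k

theorem integrable_mix (j : ℕ) (F : CMat N p q) (k : Cube N) (a : Fin p) (b : Fin q) :
    Integrable fun k' => F (mix j k' k) a b :=
  Continuous.integrable_of_compact ((F.continuous.matrix_elem a b).comp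
    ((continuous_mix j).comp (Continuous.prodMk_left k)))

theorem cmul_assoc {t : ℕ} (A : CMat N p q) (B : CMat N q r) (C : CMat N r t) :
    A ⊡ B ⊡ C = A ⊡ (B ⊡ C) := by
  ext1 k; simp [Matrix.mul_assoc]

@[simp] theorem oneMat_cmul (A : CMat N p q) : oneMat p ⊡ A = A := by
  ext1 k; simp

@[simp] theorem cmul_oneMat (A : CMat N p q) : A ⊡ oneMat q = A := by
  ext1 k; simp

theorem add_cmul (A A' : CMat N p q) (B : CMat N q r) : (A + A') ⊡ B = A ⊡ B + A' ⊡ B := by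
  ext1 k; simp [Matrix.add_mul]

theorem cmul_add (A : CMat N p q) (B B' : CMat N q r) : A ⊡ (B + B') = A ⊡ B + A ⊡ B' := by
  ext1 k; simp [Matrix.mul_add]

theorem smul_cmul (c : ℂ) (A : CMat N p q) (B : CMat N q r) : (c • A) ⊡ B = c • (A ⊡ B) := by
  ext1 k; simp

theorem avgC_add (j : ℕ) (F G : CMat N p q) : avgC j (F + G) = avgC j F + avgC j G := by
  ext k a b
  simp only [ContinuousMap.add_apply, Matrix.add_apply, avgC_elem]
  exact integral_add (integrable_mix j F k a b) (integrable_mix j G k a b)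

/-- `F` does not depend on the first `j` variables. -/
def IsTail (j : ℕ) (F : CMat N p q) : Prop := ∀ k' k, F (mix j k' k) = F k

theorem isTail_avgC {i j : ℕ} (h : i ≤ j) (F : CMat N p q) : IsTail i (avgC j F) := by
  intro k' k
  simp only [avgC_apply, tail_mix h]

theorem isTail_const (j : ℕ) (A : Matrix (Fin p) (Fin q) ℂ) :
    IsTail j (ContinuousMap.const (Cube N) A) := fun _ _ => rfl

theorem avgC_cmul_of_isTail_right (j : ℕ) (F : CMat N p q) {G : CMat N q r} (hG : IsTail j G) :
    avgC j (F ⊡ G) = avgC j F ⊡ G := by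
  ext k a b
  simp only [cmul_apply, Matrix.mul_apply, avgC_elem]
  simp_rw [hG _ k]
  rw [integral_finsetSum]
  · simp_rw [integral_mul_const]
  · exact fun c _ => (integrable_mix j F k a c).mul_const _

theorem avgC_cmul_of_isTail_left (j : ℕ) {F : CMat N p q} (hF : IsTail j F) (G : CMat N q r) :
    avgC j (F ⊡ G) = F ⊡ avgC j G := by
  ext k a b
  simp only [cmul_apply, Matrix.mul_apply, avgC_elem]
  simp_rw [hF _ k]
  rw [integral_finsetSum]
  · simp_rw [integral_const_mul]
  · exact fun c _ => (integrable_mix j G k c b).const_mul _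

theorem avgC_of_isTail (j : ℕ) {F : CMat N p q} (hF : IsTail j F) : avgC j F = F := by
  ext k a b
  rw [avgC_elem]
  simp_rw [hF _ k]
  simp

/-- By `mix_mix` the iterated average is a double integral of a function of `mix j k' k`, and `mix
j` carries the product measure to the measure of the cube. -/
theorem avgC_avgC_of_le {i j : ℕ} (h : j ≤ i) (F : CMat N p q) :
    avgC i (avgC j F) = avgC i F := by
  ext k a b
  simp only [avgC_elem]
  simp_rw [mix_mix h]
  have hc : Continuous fun z : Cube N × Cube N => F (mix i (mix j z.1 z.2) k) a b :=
    (F.continuous.matrix_elem a b).comp ((continuous_mix i).comp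
      ((continuous_mix j).prodMk continuous_const))
  have hc' : Continuous fun z : Cube N => F (mix i z k) a b :=
    (F.continuous.matrix_elem a b).comp ((continuous_mix i).comp (Continuous.prodMk_left k))
  have hp := integral_prod_symm _ (Continuous.integrable_of_compact hc
    (μ := (volume : Measure (Cube N)).prod (volume : Measure (Cube N))))
  rw [← hp]
  have hm := measurePreserving_mix (N := N) j
  conv_rhs => rw [← hm.map_eq]
  rw [integral_map hm.measurable.aemeasurable hc'.aestronglyMeasurable]
  rfl

theorem avgC_cmul_avgC_of_le {i j : ℕ} (h : i ≤ j) (G : CMat N p q) (F : CMat N q r) :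
    avgC i (G ⊡ avgC j F) = avgC i G ⊡ avgC j F :=
  avgC_cmul_of_isTail_right i G (isTail_avgC h F)

/-- Both sides equal `⟨⟨G⟩_j ⟨F⟩_j⟩_i`: the outer average may be preceded by `⟨·⟩_j`, which pulls
out the factor already averaged. -/
theorem avgC_cmul_avgC_of_ge {i j : ℕ} (h : j ≤ i) (G : CMat N p q) (F : CMat N q r) :
    avgC i (G ⊡ avgC j F) = avgC i (avgC j G ⊡ F) := by
  rw [← avgC_avgC_of_le h (G ⊡ avgC j F), avgC_cmul_avgC_of_le le_rfl,
    ← avgC_cmul_of_isTail_left j (isTail_avgC le_rfl G) F, avgC_avgC_of_le h]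

theorem isTail_zero (F : CMat N p q) : IsTail 0 F := by
  intro k' k
  congr 1

theorem IsTail.add {j : ℕ} {F G : CMat N p q} (hF : IsTail j F)
    (hG : IsTail j G) : IsTail j (F + G) := fun k' k => by simp [hF k' k, hG k' k]

/-! ### Operators on the classes of continuous functions -/

/-- A one-column continuous matrix function as a function with values in `ℂ^p`. -/
def colFun (F : CMat N p 1) : C(Cube N, EuclideanSpace ℂ (Fin p)) :=
  ⟨fun k => WithLp.toLp 2 fun a => F k a 0,
    (PiLp.continuous_toLp 2 _).comp (continuous_pi fun a => F.continuous.matrix_elem a 0)⟩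

/-- The class in `L²` of a one-column continuous matrix function. -/
def toL2 (F : CMat N p 1) : L2 N p := ContinuousMap.toLp 2 volume ℂ (colFun F)

theorem coeFn_toL2 (F : CMat N p 1) : toL2 F =ᵐ[volume] colFun F :=
  ContinuousMap.coeFn_toLp _ _

theorem denseRange_toL2 : DenseRange (toL2 : CMat N p 1 → L2 N p) := by
  have h := ContinuousMap.toLp_denseRange (EuclideanSpace ℂ (Fin p))
    (volume : Measure (Cube N)) (p := 2) ℂ (by norm_num)
  have hs : Function.Surjective (colFun : CMat N p 1 → _) := fun f =>
    ⟨⟨fun k => Matrix.of fun a _ => f k a, continuous_matrix fun a _ =>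
      (PiLp.continuous_apply 2 _ a).comp f.continuous⟩, by ext k a; simp [colFun]⟩
  exact h.comp hs.denseRange (ContinuousMap.toLp 2 volume ℂ).continuous

theorem toL2_injective : Function.Injective (toL2 : CMat N p 1 → L2 N p) := by
  intro F G h
  have h1 : colFun F =ᵐ[volume] colFun G :=
    (coeFn_toL2 F).symm.trans ((Filter.EventuallyEq.of_eq (by rw [h])).trans (coeFn_toL2 G))
  have h2 := (Continuous.ae_eq_iff_eq volume (colFun F).continuous (colFun G).continuous).1 h1
  ext k a b
  have h3 := congrArg (fun v => v.ofLp a) (congrFun h2 k)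
  rw [Fin.fin_one_eq_zero b]
  exact h3

theorem toL2_add (F G : CMat N p 1) : toL2 (F + G) = toL2 F + toL2 G :=
  (ContinuousMap.toLp (E := EuclideanSpace ℂ (Fin p)) 2 (volume : Measure (Cube N)) ℂ).map_add
    (colFun F) (colFun G)

theorem toL2_smul (c : ℂ) (F : CMat N p 1) : toL2 (c • F) = c • toL2 F :=
  (ContinuousMap.toLp (E := EuclideanSpace ℂ (Fin p)) 2 (volume : Measure (Cube N)) ℂ).map_smul
    c (colFun F)

/-- Continuous functions are dense in `L²`, so operator identities reduce to pointwise identities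
between continuous matrix functions, with no almost-everywhere arguments. -/
theorem op_ext {T S : L2 N p →L[ℂ] L2 N q} (h : ∀ F, T (toL2 F) = S (toL2 F)) : T = S := by
  apply ContinuousLinearMap.coeFn_injective
  exact denseRange_toL2.equalizer T.continuous S.continuous (funext h)

theorem mulOp_toL2 (A : CMat N p q) (F : CMat N q 1) : mulOp A (toL2 F) = toL2 (A ⊡ F) := by
  apply Lp.ext
  filter_upwards [coeFn_mulOp A (toL2 F), coeFn_toL2 F, coeFn_toL2 (A ⊡ F)] with k h1 h2 h3
  rw [h1, h2, h3]
  ext a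
  simp [colFun, Matrix.mulVec, dotProduct, Matrix.mul_apply]

theorem avgOp_toL2 (j : ℕ) (F : CMat N p 1) : avgOp j (toL2 F) = toL2 (avgC j F) := by
  apply Lp.ext
  have h := (measurePreserving_tail (N := N) j).quasiMeasurePreserving.ae
    (ae_glue j (coeFn_toL2 F))
  filter_upwards [coeFn_avgOp j (toL2 F), h, coeFn_toL2 (avgC j F)] with k h1 h2 h3
  have h4 : avg j (toL2 F) (tail j k) = avg j (colFun F) (tail j k) := integral_congr_ae h2
  rw [h1, h3, h4, avg_tail j (colFun F).continuous]
  ext a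
  rw [eval_integral_piLp]
  · exact (avgC_elem j F k a 0).symm
  · exact fun a => integrable_mix j F k a 0

/-! ### Composition rules for multiplications and averages -/

theorem mulOp_mulOp (A : CMat N p q) (B : CMat N q r) (u : L2 N r) :
    mulOp A (mulOp B u) = mulOp (A ⊡ B) u := by
  have h : mulOp A ∘L mulOp B = mulOp (A ⊡ B) := op_ext fun F => by
    simp [mulOp_toL2, cmul_assoc]
  exact DFunLike.congr_fun h u

theorem mulOp_oneMat (u : L2 N p) : mulOp (oneMat p) u = u := by
  have h : mulOp (oneMat p) = ContinuousLinearMap.id ℂ (L2 N p) := op_ext fun F => by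
    simp [mulOp_toL2]
  exact DFunLike.congr_fun h u

theorem mulOp_add (A B : CMat N p q) : mulOp (A + B) = mulOp A + mulOp B :=
  op_ext fun F => by simp [mulOp_toL2, add_cmul, toL2_add]

theorem mulOp_smul (c : ℂ) (A : CMat N p q) : mulOp (c • A) = c • mulOp A :=
  op_ext fun F => by simp [mulOp_toL2, smul_cmul, toL2_smul]

theorem mulOp_zero : mulOp (0 : CMat N p q) = 0 := by
  simpa using mulOp_add (0 : CMat N p q) 0

theorem mulOp_neg (A : CMat N p q) : mulOp (-A) = -mulOp A := by
  refine eq_neg_of_add_eq_zero_left ?_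
  rw [← mulOp_add, neg_add_cancel, mulOp_zero]

theorem mulOp_sub (A B : CMat N p q) : mulOp (A - B) = mulOp A - mulOp B := by
  rw [sub_eq_add_neg, mulOp_add, mulOp_neg, sub_eq_add_neg]

theorem mulOp_sum {ι : Type*} (s : Finset ι) (A : ι → CMat N p q) :
    mulOp (∑ i ∈ s, A i) = ∑ i ∈ s, mulOp (A i) :=
  map_sum (⟨⟨mulOp, mulOp_zero⟩, mulOp_add⟩ : CMat N p q →+ (L2 N q →L[ℂ] L2 N p)) A s

theorem avgOp_zero (u : L2 N p) : avgOp 0 u = u := by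
  have h : avgOp 0 = ContinuousLinearMap.id ℂ (L2 N p) := op_ext fun F => by
    simp [avgOp_toL2, avgC_of_isTail 0 (isTail_zero F)]
  exact DFunLike.congr_fun h u

theorem avgOp_mulOp_of_isTail {j : ℕ} {A : CMat N p q} (hA : IsTail j A) (u : L2 N q) :
    avgOp j (mulOp A u) = mulOp A (avgOp j u) := by
  have h : avgOp j ∘L mulOp A = mulOp A ∘L avgOp j := op_ext fun F => by
    simp [mulOp_toL2, avgOp_toL2, avgC_cmul_of_isTail_left j hA]
  exact DFunLike.congr_fun h u

theorem avgOp_mulOp_avgOp_of_le {i j : ℕ} (h : i ≤ j) (G : CMat N p q) (u : L2 N q) :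
    avgOp i (mulOp G (avgOp j u)) = mulOp (avgC i G) (avgOp j u) := by
  have h : avgOp i ∘L mulOp G ∘L avgOp j = mulOp (avgC i G) ∘L avgOp j := op_ext fun F => by
    simp [mulOp_toL2, avgOp_toL2, avgC_cmul_avgC_of_le h]
  exact DFunLike.congr_fun h u

theorem avgOp_mulOp_avgOp_of_ge {i j : ℕ} (h : j ≤ i) (G : CMat N p q) (u : L2 N q) :
    avgOp i (mulOp G (avgOp j u)) = avgOp i (mulOp (avgC j G) u) := by
  have h : avgOp i ∘L mulOp G ∘L avgOp j = avgOp i ∘L mulOp (avgC j G) := op_ext fun F => by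
    simp [mulOp_toL2, avgOp_toL2, avgC_cmul_avgC_of_ge h]
  exact DFunLike.congr_fun h u

/-- A continuous matrix function is determined by its action on functions of the last
variables. -/
theorem eq_of_mulOp_avgOp {j : ℕ} {G G' : CMat N p q}
    (h : ∀ u : L2 N q, mulOp G (avgOp j u) = mulOp G' (avgOp j u)) : G = G' := by
  ext k a b
  -- The constant basis vector is fixed by every average, and multiplication by `G` turns it into
  -- the `b`-th column of `G`.
  let w : CMat N q 1 := ContinuousMap.const _ (Matrix.single b 0 1)
  have h1 := h (toL2 w)
  rw [avgOp_toL2, avgC_of_isTail j (isTail_const j _), mulOp_toL2, mulOp_toL2] at h1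
  have h2 := congrArg (fun F : CMat N p 1 => F k a 0) (toL2_injective h1)
  simpa [w, Matrix.mul_apply, Matrix.single_apply] using h2

theorem mulOp_injective : Function.Injective (mulOp : CMat N p q → _) := fun _ _ h =>
  eq_of_mulOp_avgOp (j := 0) fun _ => DFunLike.congr_fun h _

/-! ### Multiplications bounded below -/

theorem norm_toL2_sq (F : CMat N p 1) : ‖toL2 F‖ ^ 2 = ∫ k, ∑ a, ‖F k a 0‖ ^ 2 := by
  have h := L2.inner_def (𝕜 := ℂ) (toL2 F) (toL2 F)
  have h2 : ∫ k, inner ℂ (toL2 F k) (toL2 F k) = ∫ k, ((∑ a, ‖F k a 0‖ ^ 2 : ℝ) : ℂ) := by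
    apply integral_congr_ae
    filter_upwards [coeFn_toL2 F] with k hk
    rw [hk, inner_self_eq_norm_sq_to_K, EuclideanSpace.norm_eq,
      ← RCLike.ofReal_pow, Real.sq_sqrt (Finset.sum_nonneg fun _ _ => sq_nonneg _)]
    rfl
  rw [h2, integral_complex_ofReal, inner_self_eq_norm_sq_to_K] at h
  exact Complex.ofReal_injective ((Complex.ofReal_pow _ 2).trans h)

/-- A multiplication by a function of the last variables which is bounded below on the functions
of these variables is invertible pointwise. -/
theorem det_ne_zero_of_bounded_below {j : ℕ} {E : CMat N p p} (hE : IsTail j E) {c : ℝ}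
    (hc : 0 < c) (h : ∀ u : L2 N p, c * ‖avgOp j u‖ ≤ ‖mulOp E (avgOp j u)‖) (k : Cube N) :
    (E k).det ≠ 0 := by
  intro hdet
  obtain ⟨w, hw, hEw⟩ := Matrix.exists_mulVec_eq_zero_iff.2 hdet
  let S : Cube N → ℝ := fun l => ∑ a, ‖(E l).mulVec w a‖ ^ 2
  let D : Cube N → ℝ := fun l => c ^ 2 * ∑ a, ‖w a‖ ^ 2 - S l
  have hS : Continuous S := by
    refine continuous_finsetSum _ fun a _ => ?_
    exact ((continuous_apply a).comp
      (E.continuous.matrix_mulVec continuous_const)).norm.pow 2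
  have hD : Continuous D := continuous_const.sub hS
  -- The test function is `φ w`, supported where `|E w|² < c²|w|²`. The lower bound applied to it
  -- reads `∫ φ² D ≤ 0`, and `φ² D = φ³`; so `φ` vanishes identically, contrary to `D k = c²|w|² >
  -- 0`. As `E` depends on the last variables only, so does `φ`.
  let φ : Cube N → ℝ := fun l => max (D l) 0
  have hφ : Continuous φ := hD.max continuous_const
  let F : CMat N p 1 := ⟨fun l => Matrix.of fun a _ => (φ l : ℂ) * w a,
    continuous_matrix fun a _ => (Complex.continuous_ofReal.comp hφ).mul continuous_const⟩
  have hF : IsTail j F := fun k' l => by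
    simp only [F, φ, D, S, ContinuousMap.coe_mk, hE k' l]
  have h1 := h (toL2 F)
  rw [avgOp_toL2, avgC_of_isTail j hF, mulOp_toL2] at h1
  have h2 := pow_le_pow_left₀ (by positivity) h1 2
  rw [mul_pow, norm_toL2_sq, norm_toL2_sq] at h2
  have e1 : ∀ l, ∑ a, ‖F l a 0‖ ^ 2 = φ l ^ 2 * ∑ a, ‖w a‖ ^ 2 := fun l => by
    simp [F, mul_pow, Finset.mul_sum]
  have e2 : ∀ l, ∑ a, ‖(E ⊡ F) l a 0‖ ^ 2 = φ l ^ 2 * S l := fun l => by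
    rw [Finset.mul_sum]
    refine Finset.sum_congr rfl fun a _ => ?_
    have : (E ⊡ F) l a 0 = φ l * (E l).mulVec w a := by
      simp only [cmul_apply, Matrix.mul_apply, Matrix.mulVec, dotProduct, Finset.mul_sum, F,
        ContinuousMap.coe_mk, Matrix.of_apply]
      exact Finset.sum_congr rfl fun b _ => by ring
    rw [this, norm_mul, mul_pow, Complex.norm_real, Real.norm_eq_abs, sq_abs]
  simp_rw [e1, e2] at h2
  rw [← integral_const_mul, ← sub_nonpos, ← integral_sub] at h2
  · have e3 : ∀ l, c ^ 2 * (φ l ^ 2 * ∑ a, ‖w a‖ ^ 2) - φ l ^ 2 * S l = φ l ^ 3 := fun l => by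
      have : φ l * D l = φ l ^ 2 := by
        rcases le_total (D l) 0 with hl | hl
        · simp [φ, max_eq_right hl]
        · simp [φ, max_eq_left hl, sq]
      calc _ = φ l * (φ l * D l) := by simp only [D]; ring
        _ = _ := by rw [this]; ring
    simp_rw [e3] at h2
    have hnn : ∀ l, 0 ≤ φ l ^ 3 := fun l => pow_nonneg (le_max_right _ _) 3
    have h3 := le_antisymm h2 (integral_nonneg hnn)
    rw [integral_eq_zero_iff_of_nonneg hnn (Continuous.integrable_of_compact (hφ.pow 3))] at h3
    have h4 := congrFun ((Continuous.ae_eq_iff_eq volume (hφ.pow 3) continuous_const).1 h3) k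
    have h5 : φ k = 0 := (pow_eq_zero_iff three_ne_zero).1 (h4 : φ k ^ 3 = 0)
    have h6 : D k ≤ 0 := by rw [← h5]; exact le_max_left _ _
    have h7 : S k = 0 := by simp [S, hEw]
    have h8 : 0 < ∑ a, ‖w a‖ ^ 2 := by
      obtain ⟨a, ha⟩ := Function.ne_iff.1 hw
      exact Finset.sum_pos' (fun _ _ => sq_nonneg _)
        ⟨a, Finset.mem_univ a, pow_pos (norm_pos_iff.2 ha) 2⟩
    simp only [D, h7, sub_zero] at h6
    exact (mul_pos (pow_pos hc 2) h8).not_ge h6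
  · exact Continuous.integrable_of_compact
      (continuous_const.mul ((hφ.pow 2).mul continuous_const))
  · exact Continuous.integrable_of_compact ((hφ.pow 2).mul hS)

/-! ### Bessel's inequality for contractive idempotents -/

/-- A contractive idempotent is an orthogonal projection, so Pythagoras applies. Working with norms
alone avoids computing adjoints of the averages. -/
theorem norm_sq_add_norm_sub_sq_of_idem {V : Type*} [NormedAddCommGroup V] [InnerProductSpace ℂ V]
    {P : V →L[ℂ] V} (hP : ∀ u, P (P u) = P u) (hn : ∀ u, ‖P u‖ ≤ ‖u‖) (u : V) :
    ‖P u‖ ^ 2 + ‖u - P u‖ ^ 2 = ‖u‖ ^ 2 := by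
  set x := P u with hx
  set z := u - P u with hz
  have hz0 : P z = 0 := by rw [hz, map_sub, hP, sub_self]
  -- Since `P (x + t z) = x`, contractivity gives `‖x‖² ≤ ‖x + t z‖²`. A quadratic in `t` without
  -- constant term is nonnegative everywhere only if its linear coefficient is zero.
  have key : ∀ t : ℝ, 0 ≤ ‖z‖ ^ 2 * (t * t) + (2 * RCLike.re (inner ℂ x z)) * t + 0 := by
    intro t
    have h1 := hn (x + (t : ℂ) • z)
    rw [map_add, map_smul, hz0, smul_zero, add_zero, hx, hP, ← hx] at h1
    have h2 := pow_le_pow_left₀ (norm_nonneg _) h1 2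
    rw [norm_add_sq (𝕜 := ℂ), inner_smul_right, norm_smul, Complex.norm_real, mul_pow,
      Real.norm_eq_abs, sq_abs] at h2
    have h3 : RCLike.re ((t : ℂ) * inner ℂ x z) = t * RCLike.re (inner ℂ x z) :=
      Complex.re_ofReal_mul _ _
    rw [h3] at h2
    nlinarith
  have h4 := discrim_le_zero key
  have h5 : RCLike.re (inner ℂ x z) = 0 := by
    rw [discrim] at h4
    nlinarith [sq_nonneg (RCLike.re (inner ℂ x z))]
  have h6 : u = x + z := by rw [hz, hx]; abel
  rw [h6, norm_add_sq (𝕜 := ℂ), h5]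
  ring

theorem tendsto_zero_of_orthogonal_idem {V : Type*} [NormedAddCommGroup V] [InnerProductSpace ℂ V]
    {P : ℕ → V →L[ℂ] V} (hP : ∀ n u, P n (P n u) = P n u) (hn : ∀ n u, ‖P n u‖ ≤ ‖u‖)
    (h0 : ∀ n m u, n ≠ m → P n (P m u) = 0) (u : V) :
    Tendsto (fun n => P n u) atTop (𝓝 0) := by
  have key : ∀ K : ℕ, ∑ n ∈ Finset.range K, ‖P n u‖ ^ 2 +
      ‖u - ∑ n ∈ Finset.range K, P n u‖ ^ 2 = ‖u‖ ^ 2 := by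
    intro K
    induction K with
    | zero => simp
    | succ K ih =>
      have h1 := norm_sq_add_norm_sub_sq_of_idem (hP K) (hn K)
        (u - ∑ n ∈ Finset.range K, P n u)
      have h2 : P K (u - ∑ n ∈ Finset.range K, P n u) = P K u := by
        rw [map_sub, map_sum, Finset.sum_eq_zero, sub_zero]
        exact fun n hn => h0 K n u (Finset.mem_range.1 hn).ne'
      rw [h2] at h1
      rw [Finset.sum_range_succ, Finset.sum_range_succ, ← sub_sub, ← ih, ← h1]
      ring
  have hs : Summable fun n => ‖P n u‖ ^ 2 :=
    summable_of_sum_range_le (c := ‖u‖ ^ 2) (fun _ => sq_nonneg _) fun K => by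
      rw [← key K]; exact le_add_of_nonneg_right (sq_nonneg _)
  rw [tendsto_zero_iff_norm_tendsto_zero]
  have h3 := hs.tendsto_atTop_zero.sqrt
  simpa [Real.sqrt_sq] using h3

/-! ### Oscillating multipliers -/

/-- The character `exp (2πi n k_{s+1})`, or `1` if there is no such variable. -/
def osc (N s : ℕ) (n : ℤ) : C(Cube N, ℂ) :=
  if h : s < N then
    ⟨fun k => Complex.exp (2 * Real.pi * Complex.I * n * ((k ⟨s, h⟩ : ℝ) : ℂ)), by fun_prop⟩
  -- The default serves `s = N`: conjugation is then trivial, and the truncation is the whole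
  -- operator.
  else 1

/-- Multiplication by a character as a scalar matrix function. -/
def oscMat (N s p : ℕ) (n : ℤ) : CMat N p p :=
  ⟨fun k => osc N s n k • 1, continuous_matrix fun a b => by
    simp only [Matrix.smul_apply]; exact (osc N s n).continuous.smul continuous_const⟩

theorem osc_add (s : ℕ) (n m : ℤ) (k : Cube N) :
    osc N s (n + m) k = osc N s n k * osc N s m k := by
  by_cases h : s < N
  · simp only [osc, h, dif_pos, ContinuousMap.coe_mk, ← Complex.exp_add]
    push_cast
    ring_nf
  · simp [osc, h]

theorem osc_zero (s : ℕ) (k : Cube N) : osc N s 0 k = 1 := by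
  by_cases h : s < N <;> simp [osc, h]

theorem norm_osc (s : ℕ) (n : ℤ) (k : Cube N) : ‖osc N s n k‖ = 1 := by
  by_cases h : s < N
  · simp [osc, h, Complex.norm_exp]
  · simp [osc, h]

theorem oscMat_apply (s : ℕ) (n : ℤ) (k : Cube N) :
    oscMat N s p n k = osc N s n k • 1 := rfl

theorem oscMat_cmul_oscMat (s : ℕ) (n m : ℤ) :
    oscMat N s p n ⊡ oscMat N s p m = oscMat N s p (n + m) := by
  ext1 k
  simp [oscMat_apply, osc_add, smul_smul, mul_comm]

theorem oscMat_zero (s : ℕ) : oscMat N s p 0 = oneMat p := by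
  ext1 k
  simp [oscMat_apply, osc_zero]

theorem oscMat_cmul (s : ℕ) (n : ℤ) (A : CMat N p q) :
    oscMat N s p n ⊡ A = A ⊡ oscMat N s q n := by
  ext1 k
  simp [oscMat_apply]

theorem isTail_oscMat {j s : ℕ} (h : j ≤ s) (n : ℤ) : IsTail j (oscMat N s p n) := by
  intro k' k
  simp only [oscMat_apply]
  congr 1
  by_cases hs : s < N
  · simp [osc, hs, mix, h.not_gt]
  · simp [osc, hs]

theorem integral_osc {s : ℕ} (hs : s < N) {n : ℤ} (hn : n ≠ 0) : ∫ k, osc N s n k = 0 := by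
  simp only [osc, hs, dif_pos, ContinuousMap.coe_mk]
  have hm : MeasurePreserving (Function.eval (⟨s, hs⟩ : Fin N) : Cube N → I) :=
    measurePreserving_eval (fun _ => (volume : Measure I)) _
  have hc : (2 * Real.pi * Complex.I * n : ℂ) ≠ 0 := by
    simp [Real.pi_ne_zero, hn]
  have hcont : Continuous fun t : ℝ => Complex.exp (2 * Real.pi * Complex.I * n * (t : ℂ)) := by
    fun_prop
  have h1 := integral_map hm.measurable.aemeasurable (μ := (volume : Measure (Cube N)))
    (f := fun t : I => Complex.exp (2 * Real.pi * Complex.I * n * ((t : ℝ) : ℂ)))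
    (hcont.comp continuous_subtype_val).aestronglyMeasurable
  rw [hm.map_eq] at h1
  refine h1.symm.trans ?_
  rw [integral_subtype measurableSet_Icc
    (fun t : ℝ => Complex.exp (2 * Real.pi * Complex.I * n * (t : ℂ))),
    integral_Icc_eq_integral_Ioc, ← intervalIntegral.integral_of_le zero_le_one,
    integral_exp_mul_complex hc]
  have h2 : Complex.exp (2 * Real.pi * Complex.I * n * ((1 : ℝ) : ℂ)) = 1 := by
    rw [Complex.exp_eq_one_iff]
    exact ⟨n, by push_cast; ring⟩
  rw [h2]
  simp

theorem avgC_oscMat {s j : ℕ} (hs : s < N) (hj : s < j) {n : ℤ} (hn : n ≠ 0) :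
    avgC j (oscMat N s p n) = 0 := by
  ext k a b
  rw [avgC_elem]
  have h : ∀ k', oscMat N s p n (mix j k' k) a b =
      osc N s n k' * (1 : Matrix (Fin p) (Fin p) ℂ) a b := fun k' => by
    simp [oscMat_apply, osc, hs, mix, hj]
  simp_rw [h]
  rw [integral_mul_const, integral_osc hs hn, zero_mul]
  rfl

theorem mulOp_oscMat_oscMat (s : ℕ) (n m : ℤ) (u : L2 N p) :
    mulOp (oscMat N s p n) (mulOp (oscMat N s p m) u) = mulOp (oscMat N s p (n + m)) u := by
  rw [mulOp_mulOp, oscMat_cmul_oscMat]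

theorem norm_mulOp_oscMat (s : ℕ) (n : ℤ) (u : L2 N p) : ‖mulOp (oscMat N s p n) u‖ = ‖u‖ := by
  have h : ∀ᵐ k, ‖mulOp (oscMat N s p n) u k‖ = ‖u k‖ := by
    filter_upwards [coeFn_mulOp (oscMat N s p n) u] with k hk
    rw [hk, oscMat_apply, Matrix.smul_mulVec, Matrix.one_mulVec, WithLp.toLp_smul, norm_smul,
      norm_osc, one_mul]
  exact le_antisymm (Lp.norm_le_norm_of_ae_le (h.mono fun _ h => h.le))
    (Lp.norm_le_norm_of_ae_le (h.mono fun _ h => h.ge))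

theorem norm_avgOp_le (j : ℕ) (u : L2 N p) : ‖avgOp j u‖ ≤ ‖u‖ := by
  simpa using (avgOp j : L2 N p →L[ℂ] L2 N p).le_of_opNorm_le
    (LinearMap.mkContinuous_norm_le _ zero_le_one _) u

/-- A Riemann–Lebesgue lemma: with `e_n` the character, the operators `e_{-n}⟨e_n ·⟩_j` are
contractive idempotents which annihilate one another, because `⟨e_{n-m}⟩_j = 0` for `n ≠ m`. -/
theorem tendsto_avgOp_osc {s j : ℕ} (hs : s < N) (hj : s < j) (u : L2 N p) :
    Tendsto (fun n : ℕ => avgOp j (mulOp (oscMat N s p n) u)) atTop (𝓝 0) := by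
  let P : ℕ → L2 N p →L[ℂ] L2 N p := fun n =>
    mulOp (oscMat N s p (-n)) ∘L avgOp j ∘L mulOp (oscMat N s p n)
  have hPP : ∀ (n m : ℕ) u, P n (P m u) = mulOp (oscMat N s p (-n))
      (mulOp (avgC j (oscMat N s p (n - m))) (avgOp j (mulOp (oscMat N s p m) u))) := by
    intro n m u
    simp only [P, ContinuousLinearMap.comp_apply, mulOp_oscMat_oscMat]
    rw [avgOp_mulOp_avgOp_of_le le_rfl, ← sub_eq_add_neg]
  have h := tendsto_zero_of_orthogonal_idem (P := P) ?_ ?_ ?_ u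
  · rw [tendsto_zero_iff_norm_tendsto_zero] at h ⊢
    refine h.congr fun n => ?_
    simp only [P, ContinuousLinearMap.comp_apply, norm_mulOp_oscMat]
  · intro n u
    rw [hPP, sub_self, oscMat_zero, avgC_of_isTail j (F := oneMat p) (isTail_const j _), mulOp_oneMat]
    rfl
  · intro n u
    simp only [P, ContinuousLinearMap.comp_apply, norm_mulOp_oscMat]
    exact (norm_avgOp_le j _).trans (norm_mulOp_oscMat s _ u).le
  · intro n m u hnm
    rw [hPP, avgC_oscMat hs hj (sub_ne_zero.2 (by exact_mod_cast hnm)), mulOp_zero]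
    simp

/-! ### Truncation as a strong limit -/

/-- `P` is the strong limit of the conjugates of `T` by the characters of the variable
`k_{s+1}`. -/
def IsTrunc (s : ℕ) (T P : L2 N M →L[ℂ] L2 N M) : Prop :=
  ∀ u, Tendsto (fun n : ℕ => mulOp (oscMat N s M (-n)) (T (mulOp (oscMat N s M n) u)))
    atTop (𝓝 (P u))

theorem osc_neg_osc (s : ℕ) (n : ℤ) (u : L2 N p) :
    mulOp (oscMat N s p (-n)) (mulOp (oscMat N s p n) u) = u := by
  rw [mulOp_oscMat_oscMat, neg_add_cancel, oscMat_zero, mulOp_oneMat]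

theorem osc_osc_neg (s : ℕ) (n : ℤ) (u : L2 N p) :
    mulOp (oscMat N s p n) (mulOp (oscMat N s p (-n)) u) = u := by
  rw [mulOp_oscMat_oscMat, add_neg_cancel, oscMat_zero, mulOp_oneMat]

namespace IsTrunc

variable {s : ℕ} {T T' P P' : L2 N M →L[ℂ] L2 N M}

theorem unique (h : IsTrunc s T P) (h' : IsTrunc s T P') : P = P' :=
  ContinuousLinearMap.ext fun u => tendsto_nhds_unique (h u) (h' u)

theorem add (h : IsTrunc s T P) (h' : IsTrunc s T' P') : IsTrunc s (T + T') (P + P') := fun u => by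
  simpa using (h u).add (h' u)

theorem zero : IsTrunc s (0 : L2 N M →L[ℂ] L2 N M) 0 := fun u => by
  simp

theorem sum {ι : Type*} (t : Finset ι) {f g : ι → L2 N M →L[ℂ] L2 N M}
    (h : ∀ i ∈ t, IsTrunc s (f i) (g i)) : IsTrunc s (∑ i ∈ t, f i) (∑ i ∈ t, g i) := by
  classical
  induction t using Finset.induction_on with
  | empty => simpa using zero
  | insert a t ha ih =>
    rw [Finset.sum_insert ha, Finset.sum_insert ha]
    exact (h a (Finset.mem_insert_self a t)).add
      (ih fun i hi => h i (Finset.mem_insert_of_mem hi))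

theorem mul (h : IsTrunc s T P) (h' : IsTrunc s T' P') : IsTrunc s (T * T') (P * P') := fun u => by
  have h1 := h (P' u)
  -- The conjugate of `TT'` is the product of the conjugates. The conjugates of `T` have norm at
  -- most `‖T‖`, so strong limits multiply.
  have h2 : Tendsto (fun n : ℕ => mulOp (oscMat N s M (-n)) (T (mulOp (oscMat N s M n)
      (mulOp (oscMat N s M (-n)) (T' (mulOp (oscMat N s M n) u)) - P' u)))) atTop (𝓝 0) := by
    have h3 := (tendsto_iff_norm_sub_tendsto_zero.1 (h' u)).const_mul ‖T‖
    rw [mul_zero] at h3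
    refine squeeze_zero_norm (fun n => ?_) h3
    rw [norm_mulOp_oscMat]
    exact (T.le_opNorm _).trans_eq (by rw [norm_mulOp_oscMat])
  have h4 := h2.add h1
  rw [zero_add] at h4
  refine h4.congr fun n => ?_
  simp only [map_sub, osc_osc_neg, mul_apply_eq_comp, sub_add_cancel]

theorem bounded_below (h : IsTrunc s T P) {c : ℝ} (hc : ∀ u, c * ‖u‖ ≤ ‖T u‖) (u : L2 N M) :
    c * ‖u‖ ≤ ‖P u‖ := by
  refine ge_of_tendsto' (h u).norm fun n => ?_
  rw [norm_mulOp_oscMat]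
  exact (norm_mulOp_oscMat s n u).symm ▸ hc (mulOp (oscMat N s M n) u)

end IsTrunc

theorem mulOp_osc_comm (s : ℕ) (n : ℤ) (A : CMat N p q) (u : L2 N q) :
    mulOp A (mulOp (oscMat N s q n) u) = mulOp (oscMat N s p n) (mulOp A u) := by
  rw [mulOp_mulOp, mulOp_mulOp, oscMat_cmul]

theorem sandwich_apply (j : ℕ) (A : CMat N M q) (B : CMat N q M) (u : L2 N M) :
    sandwich j A B u = mulOp A (avgOp j (mulOp B u)) := rfl

theorem isTrunc_of_comm {s : ℕ} {T : L2 N M →L[ℂ] L2 N M}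
    (h : ∀ (n : ℤ) u, T (mulOp (oscMat N s M n) u) = mulOp (oscMat N s M n) (T u)) :
    IsTrunc s T T := fun u => by
  simp_rw [h, osc_neg_osc]
  exact tendsto_const_nhds

theorem isTrunc_mulOp (s : ℕ) (A : CMat N M M) : IsTrunc s (mulOp A) (mulOp A) :=
  isTrunc_of_comm fun n u => mulOp_osc_comm s n A u

theorem isTrunc_one (s : ℕ) : IsTrunc s (1 : L2 N M →L[ℂ] L2 N M) 1 :=
  isTrunc_of_comm fun _ _ => rfl

theorem isTrunc_sandwich_of_le {s j : ℕ} (h : j ≤ s) (A : CMat N M q) (B : CMat N q M) :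
    IsTrunc s (sandwich j A B) (sandwich j A B) :=
  isTrunc_of_comm fun n u => by
    rw [sandwich_apply, mulOp_osc_comm, avgOp_mulOp_of_isTail (isTail_oscMat h n),
      mulOp_osc_comm, sandwich_apply]

theorem isTrunc_sandwich_of_lt {s j : ℕ} (h : s < j) (hs : s < N) (A : CMat N M q)
    (B : CMat N q M) : IsTrunc s (sandwich j A B) 0 := fun u => by
  have h1 := (tendsto_avgOp_osc hs h (mulOp B u)).norm.const_mul ‖mulOp A‖
  rw [norm_zero, mul_zero] at h1
  refine squeeze_zero_norm (fun n => ?_) h1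
  rw [norm_mulOp_oscMat, sandwich_apply, mulOp_osc_comm]
  exact (mulOp A).le_opNorm _

/-! ### Block matrix functions -/

/-- The block row `[A, A']`. -/
def hcat (A : CMat N p m) (A' : CMat N p m') : CMat N p (m + m') :=
  ⟨fun k => Matrix.of fun a => Fin.append (A k a) (A' k a), continuous_matrix fun a b => by
    refine Fin.addCases (fun i => ?_) (fun i => ?_) b
    · simpa using A.continuous.matrix_elem a i
    · simpa using A'.continuous.matrix_elem a i⟩

/-- The block column `[B; B']`. -/
def vcat (B : CMat N m p) (B' : CMat N m' p) : CMat N (m + m') p :=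
  ⟨fun k => Matrix.of fun a b => Fin.append (fun i => B k i b) (fun i => B' k i b) a, continuous_matrix fun a b => by
    refine Fin.addCases (fun i => ?_) (fun i => ?_) a
    · simpa using B.continuous.matrix_elem i b
    · simpa using B'.continuous.matrix_elem i b⟩

@[simp] theorem hcat_left (A : CMat N p m) (A' : CMat N p m') (k : Cube N) (a : Fin p)
    (i : Fin m) : hcat A A' k a (Fin.castAdd m' i) = A k a i := by simp [hcat]

@[simp] theorem hcat_right (A : CMat N p m) (A' : CMat N p m') (k : Cube N) (a : Fin p)
    (i : Fin m') : hcat A A' k a (Fin.natAdd m i) = A' k a i := by simp [hcat]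

@[simp] theorem vcat_left (B : CMat N m p) (B' : CMat N m' p) (k : Cube N) (a : Fin p)
    (i : Fin m) : vcat B B' k (Fin.castAdd m' i) a = B k i a := by simp [vcat]

@[simp] theorem vcat_right (B : CMat N m p) (B' : CMat N m' p) (k : Cube N) (a : Fin p)
    (i : Fin m') : vcat B B' k (Fin.natAdd m i) a = B' k i a := by simp [vcat]

theorem hcat_cmul_vcat (A : CMat N p m) (A' : CMat N p m') (B : CMat N m q) (B' : CMat N m' q) :
    hcat A A' ⊡ vcat B B' = A ⊡ B + A' ⊡ B' := by
  ext k a b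
  simp [Matrix.mul_apply, Fin.sum_univ_add]

theorem vcat_cmul (B : CMat N m p) (B' : CMat N m' p) (F : CMat N p q) :
    vcat B B' ⊡ F = vcat (B ⊡ F) (B' ⊡ F) := by
  ext k a b
  refine Fin.addCases (fun i => ?_) (fun i => ?_) a <;> simp [Matrix.mul_apply]

theorem avgC_vcat (j : ℕ) (B : CMat N m p) (B' : CMat N m' p) :
    avgC j (vcat B B') = vcat (avgC j B) (avgC j B') := by
  ext k a b
  refine Fin.addCases (fun i => ?_) (fun i => ?_) a <;> simp [avgC_elem]

/-! ### Sums and products of operators `𝐀⟨𝐁·⟩_j` -/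

theorem sandwich_toL2 (j : ℕ) (A : CMat N M q) (B : CMat N q M) (F : CMat N M 1) :
    sandwich j A B (toL2 F) = toL2 (A ⊡ avgC j (B ⊡ F)) := by
  rw [sandwich_apply, mulOp_toL2, avgOp_toL2, mulOp_toL2]

theorem sandwich_add_sandwich (j : ℕ) (A : CMat N M m) (B : CMat N m M) (A' : CMat N M m')
    (B' : CMat N m' M) :
    sandwich j A B + sandwich j A' B' = sandwich j (hcat A A') (vcat B B') := op_ext fun F => by
  simp [sandwich_toL2, vcat_cmul, avgC_vcat, hcat_cmul_vcat, toL2_add]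

theorem sandwich_add_left (j : ℕ) (A A' : CMat N M m) (B : CMat N m M) :
    sandwich j (A + A') B = sandwich j A B + sandwich j A' B := by
  simp [sandwich, mulOp_add]

theorem sandwich_smul_left (j : ℕ) (c : ℂ) (A : CMat N M m) (B : CMat N m M) :
    sandwich j (c • A) B = c • sandwich j A B := by
  simp [sandwich, mulOp_smul]

theorem sandwich_zero_left (j : ℕ) (B : CMat N m M) : sandwich j (0 : CMat N M m) B = 0 := by
  simp [sandwich, mulOp_zero]

theorem sandwich_mul_sandwich_of_le {i j : ℕ} (h : i ≤ j) (A : CMat N M m) (B : CMat N m M)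
    (C : CMat N M q) (D : CMat N q M) :
    sandwich i A B * sandwich j C D = sandwich j (A ⊡ avgC i (B ⊡ C)) D :=
  ContinuousLinearMap.ext fun u => by
    simp only [mul_apply_eq_comp, sandwich_apply]
    rw [mulOp_mulOp B C, avgOp_mulOp_avgOp_of_le h, mulOp_mulOp]

theorem sandwich_mul_sandwich_of_ge {i j : ℕ} (h : j ≤ i) (A : CMat N M m) (B : CMat N m M)
    (C : CMat N M q) (D : CMat N q M) :
    sandwich i A B * sandwich j C D = sandwich i A (avgC j (B ⊡ C) ⊡ D) :=
  ContinuousLinearMap.ext fun u => by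
    simp only [mul_apply_eq_comp, sandwich_apply]
    rw [mulOp_mulOp B C, avgOp_mulOp_avgOp_of_ge h, mulOp_mulOp]

/-! ### The filtration of the algebra -/

/-- The operators of the form `𝐀⟨𝐁·⟩_j`. -/
def sandwiches (N M j : ℕ) : Submodule ℂ (L2 N M →L[ℂ] L2 N M) where
  carrier := {T | ∃ m : ℕ, 0 < m ∧ ∃ (A : CMat N M m) (B : CMat N m M), T = sandwich j A B}
  zero_mem' := ⟨1, one_pos, 0, 0, (sandwich_zero_left j _).symm⟩
  add_mem' := by
    rintro _ _ ⟨m, hm, A, B, rfl⟩ ⟨m', -, A', B', rfl⟩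
    exact ⟨m + m', by omega, _, _, sandwich_add_sandwich j A B A' B'⟩
  smul_mem' := by
    rintro c _ ⟨m, hm, A, B, rfl⟩
    exact ⟨m, hm, c • A, B, (sandwich_smul_left j c A B).symm⟩

theorem sandwich_mem_sandwiches (j : ℕ) (A : CMat N M m) (B : CMat N m M) :
    sandwich j A B ∈ sandwiches N M j :=
  -- A zero column and row are added because `m` may be `0`, whereas `sandwiches` asks for a
  -- positive size.
  ⟨m + 1, m.succ_pos, hcat A 0, vcat B 0, by
    rw [← sandwich_add_sandwich, sandwich_zero_left, add_zero]⟩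

/-- The operators `𝐀_0· + 𝐀_1⟨𝐁_1·⟩_1 + … + 𝐀_s⟨𝐁_s·⟩_s`. -/
def filt (N M s : ℕ) : Submodule ℂ (L2 N M →L[ℂ] L2 N M) :=
  ⨆ j ∈ Finset.range (s + 1), sandwiches N M j

theorem sandwiches_le_filt {j s : ℕ} (h : j ≤ s) : sandwiches N M j ≤ filt N M s :=
  le_iSup₂_of_le j (Finset.mem_range.2 (Nat.lt_succ_of_le h)) le_rfl

theorem sandwich_mem_filt {j s : ℕ} (h : j ≤ s) (A : CMat N M m) (B : CMat N m M) :
    sandwich j A B ∈ filt N M s :=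
  sandwiches_le_filt h (sandwich_mem_sandwiches j A B)

theorem filt_mono {s t : ℕ} (h : s ≤ t) : filt N M s ≤ filt N M t :=
  iSup₂_le fun _ hj => sandwiches_le_filt ((Nat.le_of_lt_succ (Finset.mem_range.1 hj)).trans h)

theorem mulOp_eq_sandwich (A : CMat N M M) : mulOp A = sandwich 0 A (oneMat M) :=
  ContinuousLinearMap.ext fun u => by rw [sandwich_apply, avgOp_zero, mulOp_oneMat]

theorem sandwich_zero (A : CMat N M m) (B : CMat N m M) : sandwich 0 A B = mulOp (A ⊡ B) :=
  ContinuousLinearMap.ext fun u => by rw [sandwich_apply, avgOp_zero, mulOp_mulOp]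

theorem mulOp_mem_filt (s : ℕ) (A : CMat N M M) : mulOp A ∈ filt N M s :=
  mulOp_eq_sandwich A ▸ sandwich_mem_filt s.zero_le _ _

theorem one_eq_mulOp : (1 : L2 N M →L[ℂ] L2 N M) = mulOp (oneMat M) :=
  ContinuousLinearMap.ext fun u => (mulOp_oneMat u).symm

theorem one_mem_filt (s : ℕ) : (1 : L2 N M →L[ℂ] L2 N M) ∈ filt N M s :=
  one_eq_mulOp (N := N) (M := M) ▸ mulOp_mem_filt s _

theorem filt_induction {s : ℕ} {p : (L2 N M →L[ℂ] L2 N M) → Prop}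
    (h0 : p 0) (hadd : ∀ T T', p T → p T' → p (T + T'))
    (hs : ∀ (j m : ℕ) (A : CMat N M m) (B : CMat N m M), j ≤ s → p (sandwich j A B))
    {T : L2 N M →L[ℂ] L2 N M} (hT : T ∈ filt N M s) : p T := by
  obtain ⟨μ, rfl⟩ := (Submodule.mem_iSup_finset_iff_exists_sum _ T).1 hT
  refine Finset.sum_induction _ p hadd h0 fun j hj => ?_
  obtain ⟨m, -, A, B, h⟩ := (μ j).2
  rw [h]
  exact hs j m A B (Nat.le_of_lt_succ (Finset.mem_range.1 hj))

theorem mul_mem_filt {s : ℕ} {T T' : L2 N M →L[ℂ] L2 N M} (hT : T ∈ filt N M s)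
    (hT' : T' ∈ filt N M s) : T * T' ∈ filt N M s := by
  refine filt_induction (p := fun T => T * T' ∈ filt N M s) ?_ (fun _ _ h h' => ?_)
    (fun i m A B hi => ?_) hT
  · rw [zero_mul]; exact zero_mem _
  · rw [add_mul]; exact add_mem h h'
  · refine filt_induction (p := fun T' => sandwich i A B * T' ∈ filt N M s) ?_
      (fun _ _ h h' => ?_) (fun j m' C D hj => ?_) hT'
    · rw [mul_zero]; exact zero_mem _
    · rw [mul_add]; exact add_mem h h'
    · rcases le_total i j with h | h
      · rw [sandwich_mul_sandwich_of_le h]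
        exact sandwich_mem_filt hj _ _
      · rw [sandwich_mul_sandwich_of_ge h]
        exact sandwich_mem_filt hi _ _

theorem avgOp_eq_sandwich (j : ℕ) : avgOp j = sandwich j (oneMat M : CMat N M M) (oneMat M) :=
  ContinuousLinearMap.ext fun u => by rw [sandwich_apply, mulOp_oneMat, mulOp_oneMat]

theorem sandwich_mem_H {j : ℕ} (hj : j ≤ N) (A : CMat N M m) (B : CMat N m M) :
    sandwich j A B ∈ H N M := by
  have hmul : ∀ A : CMat N M M, mulOp A ∈ H N M := fun A =>
    Algebra.subset_adjoin (Or.inl ⟨A, rfl⟩)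
  have havg : (avgOp j : L2 N M →L[ℂ] L2 N M) ∈ H N M := by
    rcases j with _ | j
    · rw [avgOp_eq_sandwich, sandwich_zero]
      exact hmul _
    · exact Algebra.subset_adjoin (Or.inr ⟨⟨j, hj⟩, rfl⟩)
  rcases M.eq_zero_or_pos with rfl | hM
  · have h0 : A = 0 := by
      ext k a
      exact a.elim0
    rw [h0, sandwich_zero_left]
    exact zero_mem _
  · let i₀ : Fin M := ⟨0, hM⟩
    -- The generator `⟨·⟩_j` acts on `ℂ^M`-valued functions, while here `ℂ^m` stands in the middle.
    -- Each component of `𝐁u` is therefore sent separately through the coordinate `i₀` of `ℂ^M`;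
    -- this needs `M > 0`.
    have h : sandwich j A B = ∑ a : Fin m,
        mulOp (A ⊡ ContinuousMap.const _ (Matrix.single a i₀ 1)) * avgOp j *
          mulOp (ContinuousMap.const _ (Matrix.single i₀ a 1) ⊡ B) := by
      refine ContinuousLinearMap.ext fun u => ?_
      rw [sum_apply]
      simp only [mul_apply_eq_comp]
      have h1 : ∀ a : Fin m, mulOp (A ⊡ ContinuousMap.const _ (Matrix.single a i₀ 1))
          (avgOp j (mulOp (ContinuousMap.const _ (Matrix.single i₀ a 1) ⊡ B) u)) =
          mulOp (A ⊡ ContinuousMap.const _ (Matrix.single a a 1)) (avgOp j (mulOp B u)) := by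
        intro a
        rw [← mulOp_mulOp _ B, avgOp_mulOp_of_isTail (isTail_const j _), mulOp_mulOp, cmul_assoc]
        congr 3
        ext1 k
        simp
      simp_rw [h1]
      rw [← sum_apply, ← mulOp_sum, sandwich_apply]
      congr 2
      ext k a b
      simp [Matrix.mul_apply, Matrix.single_apply, ContinuousMap.sum_apply, Matrix.sum_apply,
        ite_and]
    rw [h]
    exact sum_mem fun a _ => mul_mem (mul_mem (hmul _) havg) (hmul _)

theorem filt_subset_H {T : L2 N M →L[ℂ] L2 N M} (hT : T ∈ filt N M N) : T ∈ H N M :=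
  filt_induction (zero_mem _) (fun _ _ => add_mem) (fun _ _ A B hj => sandwich_mem_H hj A B) hT

theorem H_subset_filt {T : L2 N M →L[ℂ] L2 N M} (hT : T ∈ H N M) : T ∈ filt N M N := by
  refine Algebra.adjoin_induction ?_ ?_ (fun _ _ _ _ => add_mem)
    (fun _ _ _ _ => mul_mem_filt) hT
  · rintro _ (⟨A, rfl⟩ | ⟨j, rfl⟩)
    · exact mulOp_mem_filt N A
    · have h := sandwich_mem_filt (N := N) (M := M) (s := N) (j := j.1 + 1) j.2 (oneMat M) (oneMat M)
      rwa [← avgOp_eq_sandwich] at h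
  · intro c
    rw [Algebra.algebraMap_eq_smul_one]
    exact Submodule.smul_mem _ c (one_mem_filt N)

theorem exists_rep_of_mem_filt {T : L2 N M →L[ℂ] L2 N M} (hT : T ∈ filt N M N) :
    ∃ R : Rep N M, R.toOp = T := by
  obtain ⟨μ, rfl⟩ := (Submodule.mem_iSup_finset_iff_exists_sum _ T).1 hT
  have h := fun j => (μ j).2
  choose m hm A B hAB using h
  refine ⟨⟨fun i => m (i.1 + 1), fun i => hm _, A 0 ⊡ B 0, fun i => A (i.1 + 1),
    fun i => B (i.1 + 1)⟩, ?_⟩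
  rw [Finset.sum_range_succ', add_comm, Rep.toOp, hAB 0, sandwich_zero,
    ← Fin.sum_univ_eq_sum_range (fun i => ((μ (i + 1) : sandwiches N M (i + 1)) :
      L2 N M →L[ℂ] L2 N M))]
  congr 1
  exact Finset.sum_congr rfl fun i _ => (hAB _).symm

/-! ### Action of the filtration on matrix functions -/

/-- A function of the last `N - t` variables passes through each `⟨·⟩_j` with `j ≤ s` as a constant
factor, so `V` acts on `𝐀` alone. With `V` the inverse of a truncation this produces the functions
`𝐀_{j,s}` of the scheme. -/
theorem exists_left_action {s t : ℕ} (h : s ≤ t) {V : L2 N M →L[ℂ] L2 N M} (hV : V ∈ filt N M s)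
    (A : CMat N M q) : ∃ A' : CMat N M q, ∀ u, V (mulOp A (avgOp t u)) = mulOp A' (avgOp t u) := by
  refine filt_induction
    (p := fun V => ∃ A' : CMat N M q, ∀ u, V (mulOp A (avgOp t u)) = mulOp A' (avgOp t u))
    ⟨0, fun u => by simp [mulOp_zero]⟩ ?_ ?_ hV
  · rintro T T' ⟨A₁, h₁⟩ ⟨A₂, h₂⟩
    exact ⟨A₁ + A₂, fun u => by simp [mulOp_add, h₁, h₂]⟩
  · intro j m C D hj
    exact ⟨C ⊡ avgC j (D ⊡ A), fun u => by
      rw [sandwich_apply, mulOp_mulOp D, avgOp_mulOp_avgOp_of_le (hj.trans h), mulOp_mulOp]⟩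

theorem exists_right_action {s t : ℕ} (h : s ≤ t) {V : L2 N M →L[ℂ] L2 N M}
    (hV : V ∈ filt N M s) (B : CMat N q M) :
    ∃ B' : CMat N q M, ∀ u, avgOp t (mulOp B (V u)) = avgOp t (mulOp B' u) := by
  refine filt_induction
    (p := fun V => ∃ B' : CMat N q M, ∀ u, avgOp t (mulOp B (V u)) = avgOp t (mulOp B' u))
    ⟨0, fun u => by simp [mulOp_zero]⟩ ?_ ?_ hV
  · rintro T T' ⟨B₁, h₁⟩ ⟨B₂, h₂⟩
    exact ⟨B₁ + B₂, fun u => by simp [mulOp_add, h₁, h₂]⟩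
  · intro j m C D hj
    exact ⟨avgC j (B ⊡ C) ⊡ D, fun u => by
      rw [sandwich_apply, mulOp_mulOp B, avgOp_mulOp_avgOp_of_ge (hj.trans h), mulOp_mulOp]⟩

/-! ### The determinant of `𝓘 + 𝐀⟨𝐁·⟩_s` -/

/-- The characteristic polynomial of `-X` is a pure power of the variable; its value at `1` is the
determinant in question. -/
theorem det_one_add_of_isNilpotent {n : Type*} [Fintype n] [DecidableEq n] {X : Matrix n n ℂ}
    (hX : IsNilpotent X) : (1 + X).det = 1 := by
  have h := Matrix.isNilpotent_charpoly_sub_pow_of_isNilpotent hX.neg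
  have h1 : (-X).charpoly = Polynomial.X ^ Fintype.card n := sub_eq_zero.1 h.eq_zero
  have h2 := Matrix.eval_charpoly (-X) 1
  rw [h1] at h2
  simpa using h2.symm

/-- The four relations say that the block matrix `X = [P, -Q; R, -S]` has square zero, so `1 + X`
has determinant `1`; a block triangular factor then carries `1 + S` to `1 + P`. -/
theorem det_one_add_eq_det_one_add {n n' : Type*} [Fintype n] [DecidableEq n] [Fintype n']
    [DecidableEq n'] {P : Matrix n n ℂ} {Q : Matrix n n' ℂ} {R : Matrix n' n ℂ}
    {S : Matrix n' n' ℂ} (h₁ : P * P = Q * R) (h₂ : P * Q = Q * S) (h₃ : R * P = S * R)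
    (h₄ : R * Q = S * S) : (1 + P).det = (1 + S).det := by
  let X := Matrix.fromBlocks P (-Q) R (-S)
  have hX : IsNilpotent X := ⟨2, by
    simp [X, sq, Matrix.fromBlocks_multiply, h₁, h₂, h₃, h₄]⟩
  have hdet := det_one_add_of_isNilpotent hX
  have hprod : (1 + X) * Matrix.fromBlocks 1 Q 0 (1 + S) = Matrix.fromBlocks (1 + P) 0 R 1 := by
    rw [← Matrix.fromBlocks_one, Matrix.fromBlocks_add, Matrix.fromBlocks_multiply]
    congr 1
    · simp
    · simp [Matrix.add_mul, Matrix.mul_add, h₂]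
      abel
    · simp
    · simp [Matrix.add_mul, Matrix.mul_add, h₄]
  have h := congrArg Matrix.det hprod
  rw [Matrix.det_mul, hdet, Matrix.det_fromBlocks_zero₂₁, Matrix.det_fromBlocks_zero₁₂] at h
  simpa using h.symm

/-- `g` has the form `𝓘 + 𝐀⟨𝐁·⟩_s` with `d = det (𝐈 + ⟨𝐁𝐀⟩_s)`. -/
def IsDet (s : ℕ) (g : L2 N M →L[ℂ] L2 N M) (d : Cube N → ℂ) : Prop :=
  ∃ (m : ℕ) (A : CMat N M m) (B : CMat N m M), g = 1 + sandwich s A B ∧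
    ∀ k, d k = (1 + avgC s (B ⊡ A) k).det

theorem avgOp_mulOp_sandwich (s : ℕ) (A : CMat N M m) (B : CMat N m M) (X : CMat N p M)
    (Y : CMat N M q) (u : L2 N q) :
    avgOp s (mulOp X (sandwich s A B (mulOp Y (avgOp s u)))) =
      mulOp (avgC s (X ⊡ A) ⊡ avgC s (B ⊡ Y)) (avgOp s u) := by
  rw [sandwich_apply, mulOp_mulOp B, avgOp_mulOp_avgOp_of_le le_rfl, mulOp_mulOp, mulOp_mulOp,
    avgOp_mulOp_avgOp_of_le le_rfl, avgC_cmul_avgC_of_le le_rfl]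

namespace IsDet

variable {s : ℕ} {g g' : L2 N M →L[ℂ] L2 N M} {d d' : Cube N → ℂ}

/-- Compressing the common operator `𝐀⟨𝐁·⟩_s = 𝐀'⟨𝐁'·⟩_s` between `⟨𝐗·⟩_s` and `𝐘⟨·⟩_s`, with `𝐗 =
𝐁, 𝐁'` and `𝐘 = 𝐀, 𝐀'`, gives the four relations of `det_one_add_eq_det_one_add`. The sizes of the
two representations may differ. -/
theorem unique (h : IsDet s g d) (h' : IsDet s g d') : d = d' := by
  obtain ⟨m, A, B, hg, hd⟩ := h
  obtain ⟨m', A', B', hg', hd'⟩ := h'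
  have hs : sandwich s A B = sandwich s A' B' := add_left_cancel (hg.symm.trans hg')
  have key : ∀ {p q : ℕ} (X : CMat N p M) (Y : CMat N M q),
      avgC s (X ⊡ A) ⊡ avgC s (B ⊡ Y) = avgC s (X ⊡ A') ⊡ avgC s (B' ⊡ Y) := fun X Y =>
    eq_of_mulOp_avgOp (j := s) fun u => by
      rw [← avgOp_mulOp_sandwich, ← avgOp_mulOp_sandwich, hs]
  funext k
  rw [hd, hd']
  exact det_one_add_eq_det_one_add (DFunLike.congr_fun (key B A) k)
    (DFunLike.congr_fun (key B A') k) (DFunLike.congr_fun (key B' A) k)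
    (DFunLike.congr_fun (key B' A') k)

theorem one (s : ℕ) : IsDet s (1 : L2 N M →L[ℂ] L2 N M) 1 :=
  ⟨0, 0, 0, by rw [sandwich_zero_left, add_zero], fun k => by simp⟩

theorem mul (h : IsDet s g d) (h' : IsDet s g' d') : IsDet s (g * g') (d * d') := by
  obtain ⟨m, A, B, rfl, hd⟩ := h
  obtain ⟨m', C, D, rfl, hd'⟩ := h'
  -- Expanding the product gives `𝓘 + 𝐀⟨𝐁·⟩ + (𝐂 + 𝐀⟨𝐁𝐂⟩)⟨𝐃·⟩`, read as one block sandwich. Its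
  -- matrix factors into a block lower triangular matrix with the two given diagonal blocks and a
  -- unipotent one.
  refine ⟨m + m', hcat A (C + A ⊡ avgC s (B ⊡ C)), vcat B D, ?_, fun k => ?_⟩
  · rw [← sandwich_add_sandwich, sandwich_add_left, mul_add, add_mul, add_mul,
      sandwich_mul_sandwich_of_le le_rfl, one_mul, one_mul, mul_one]
    abel
  · have hblock : (1 + avgC s (vcat B D ⊡ hcat A (C + A ⊡ avgC s (B ⊡ C))) k).submatrix
        finSumFinEquiv finSumFinEquiv =
        Matrix.fromBlocks (1 + avgC s (B ⊡ A) k) 0 (avgC s (D ⊡ A) k) (1 + avgC s (D ⊡ C) k) *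
          Matrix.fromBlocks 1 (avgC s (B ⊡ C) k) 0 1 := by
      have e₁ : avgC s (B ⊡ (C + A ⊡ avgC s (B ⊡ C))) =
          avgC s (B ⊡ C) + avgC s (B ⊡ A) ⊡ avgC s (B ⊡ C) := by
        rw [cmul_add, avgC_add, ← cmul_assoc, avgC_cmul_avgC_of_le le_rfl]
      have e₂ : avgC s (D ⊡ (C + A ⊡ avgC s (B ⊡ C))) =
          avgC s (D ⊡ C) + avgC s (D ⊡ A) ⊡ avgC s (B ⊡ C) := by
        rw [cmul_add, avgC_add, ← cmul_assoc, avgC_cmul_avgC_of_le le_rfl]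
      have e : ∀ {m' : ℕ} (X : CMat N M m') (i : Fin m) (j : Fin m'),
          avgC s (vcat B D ⊡ X) k (Fin.castAdd _ i) j = avgC s (B ⊡ X) k i j := fun X i j => by
        rw [vcat_cmul, avgC_vcat, vcat_left]
      have e' : ∀ {m'' : ℕ} (X : CMat N M m'') (i : Fin m') (j : Fin m''),
          avgC s (vcat B D ⊡ X) k (Fin.natAdd _ i) j = avgC s (D ⊡ X) k i j := fun X i j => by
        rw [vcat_cmul, avgC_vcat, vcat_right]
      have f : ∀ {m'' : ℕ} (X : CMat N m'' M) (i : Fin m'') (j : Fin m),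
          avgC s (X ⊡ hcat A (C + A ⊡ avgC s (B ⊡ C))) k i (Fin.castAdd _ j) =
            avgC s (X ⊡ A) k i j := fun X i j => by
        simp [avgC_elem, Matrix.mul_apply]
      have f' : ∀ {m'' : ℕ} (X : CMat N m'' M) (i : Fin m'') (j : Fin m'),
          avgC s (X ⊡ hcat A (C + A ⊡ avgC s (B ⊡ C))) k i (Fin.natAdd _ j) =
            avgC s (X ⊡ (C + A ⊡ avgC s (B ⊡ C))) k i j := fun X i j => by
        simp only [avgC_elem, cmul_apply, Matrix.mul_apply, hcat_right]
      rw [Matrix.fromBlocks_multiply]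
      ext (i | i) (j | j)
      · simp only [Matrix.submatrix_apply, finSumFinEquiv_apply_left, Matrix.add_apply, e, f,
          Matrix.fromBlocks_apply₁₁]
        simp [Matrix.one_apply]
      · simp only [Matrix.submatrix_apply, finSumFinEquiv_apply_left, finSumFinEquiv_apply_right,
          Matrix.add_apply, e, f', Matrix.fromBlocks_apply₁₂, e₁]
        simp [Matrix.one_apply, Matrix.add_mul, Fin.ext_iff]
        intro h
        omega
      · simp only [Matrix.submatrix_apply, finSumFinEquiv_apply_left, finSumFinEquiv_apply_right,
          Matrix.add_apply, e', f, Matrix.fromBlocks_apply₂₁]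
        simp [Matrix.one_apply, Fin.ext_iff]
        intro h
        omega
      · simp only [Matrix.submatrix_apply, finSumFinEquiv_apply_right, Matrix.add_apply, e', f',
          Matrix.fromBlocks_apply₂₂, e₂]
        simp [Matrix.one_apply]
        ring
    rw [← Matrix.det_submatrix_equiv_self finSumFinEquiv, hblock, Matrix.det_mul,
      Matrix.det_fromBlocks_zero₁₂, Matrix.det_fromBlocks_zero₂₁, Pi.mul_apply, hd, hd']
    simp

/-- Conjugation replaces `𝐀` by `V𝐀` and lets `U` act on `𝐁` from the right; since `UV = 1`, the
average `⟨𝐁𝐀⟩_s` itself does not change. -/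
theorem conj {t : ℕ} (ht : t ≤ s) (h : IsDet s g d) {U V : L2 N M →L[ℂ] L2 N M}
    (hU : U ∈ filt N M t) (hV : V ∈ filt N M t) (hVU : V * U = 1) (hUV : U * V = 1) :
    IsDet s (V * g * U) d := by
  obtain ⟨m, A, B, rfl, hd⟩ := h
  obtain ⟨A', hA'⟩ := exists_left_action ht hV A
  obtain ⟨B', hB'⟩ := exists_right_action ht hU B
  have hUV' : ∀ u, U (V u) = u := fun u => DFunLike.congr_fun hUV u
  have hBA : avgC s (B ⊡ A) = avgC s (B' ⊡ A') := eq_of_mulOp_avgOp (j := s) fun u => by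
    rw [← avgOp_mulOp_avgOp_of_le le_rfl, ← avgOp_mulOp_avgOp_of_le le_rfl, ← mulOp_mulOp,
      ← mulOp_mulOp, ← hA', ← hB', hUV']
  refine ⟨m, A', B', ?_, fun k => by rw [hd, hBA]⟩
  rw [mul_add, add_mul, mul_one, hVU]
  congr 1
  refine ContinuousLinearMap.ext fun u => ?_
  simp only [mul_apply_eq_comp, sandwich_apply, hA', hB']

end IsDet

/-- If `𝓘 + 𝐀⟨𝐁·⟩_s` is bounded below, then `𝐈 + ⟨𝐁𝐀⟩_s` is invertible everywhere. -/
theorem det_ne_zero_of_sandwich {s : ℕ} {A : CMat N M m} {B : CMat N m M} {c : ℝ} (hc : 0 < c)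
    (h : ∀ u, c * ‖u‖ ≤ ‖(1 + sandwich s A B) u‖) (k : Cube N) :
    (1 + avgC s (B ⊡ A) k).det ≠ 0 := by
  let E : CMat N m m := oneMat m + avgC s (B ⊡ A)
  have hE : IsTail s E := (isTail_const s _).add (isTail_avgC le_rfl _)
  -- The constant comes from `(𝓘 + 𝐀⟨𝐁·⟩)𝐀v = 𝐀𝐄v`, which bounds `‖𝐀v‖` by `‖𝐀‖‖𝐄v‖ / c`, and from
  -- `v = 𝐄v - ⟨𝐁𝐀v⟩`.
  have hK : 0 < 1 + ‖mulOp B‖ * (‖mulOp A‖ / c) := by positivity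
  refine det_ne_zero_of_bounded_below hE (inv_pos.2 hK) (fun w => ?_) k
  set v := avgOp s w with hv
  have hEv : mulOp E v = v + avgOp s (mulOp B (mulOp A v)) := by
    simp only [E]
    rw [mulOp_add, add_apply, mulOp_oneMat, mulOp_mulOp, hv,
      avgOp_mulOp_avgOp_of_le le_rfl]
  have h1 : (1 + sandwich s A B) (mulOp A v) = mulOp A (mulOp E v) := by
    rw [hEv, map_add]
    rfl
  have h2 : ‖mulOp A v‖ ≤ ‖mulOp A‖ / c * ‖mulOp E v‖ := by
    have h3 := h (mulOp A v)
    rw [h1] at h3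
    rw [div_mul_eq_mul_div, le_div_iff₀ hc, mul_comm]
    exact h3.trans ((mulOp A).le_opNorm _)
  have h4 : ‖avgOp s (mulOp B (mulOp A v))‖ ≤ ‖mulOp B‖ * (‖mulOp A‖ / c * ‖mulOp E v‖) :=
    (norm_avgOp_le s _).trans (((mulOp B).le_opNorm _).trans
      (mul_le_mul_of_nonneg_left h2 (norm_nonneg _)))
  have h5 : ‖v‖ ≤ (1 + ‖mulOp B‖ * (‖mulOp A‖ / c)) * ‖mulOp E v‖ := by
    have h6 : v = mulOp E v - avgOp s (mulOp B (mulOp A v)) := by rw [hEv]; abel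
    calc ‖v‖ ≤ ‖mulOp E v‖ + ‖avgOp s (mulOp B (mulOp A v))‖ := by
          conv_lhs => rw [h6]
          exact norm_sub_le _ _
      _ ≤ _ := by linarith
  rwa [inv_mul_le_iff₀ hK]

/-- The pointwise inverse of a continuous matrix function. -/
def cinv (E : CMat N p p) (hE : ∀ k, (E k).det ≠ 0) : CMat N p p :=
  ⟨fun k => (E k)⁻¹, by
    have h : (fun k => (E k)⁻¹) = fun k => ((E k).det)⁻¹ • (E k).adjugate := by
      funext k
      rw [Matrix.inv_def, Ring.inverse_eq_inv']
    rw [h]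
    exact (E.continuous.matrix_det.inv₀ hE).smul E.continuous.matrix_adjugate⟩

theorem cinv_cmul (E : CMat N p p) (hE : ∀ k, (E k).det ≠ 0) : cinv E hE ⊡ E = oneMat p := by
  ext1 k
  exact Matrix.nonsing_inv_mul _ (isUnit_iff_ne_zero.2 (hE k))

theorem cmul_cinv (E : CMat N p p) (hE : ∀ k, (E k).det ≠ 0) : E ⊡ cinv E hE = oneMat p := by
  ext1 k
  exact Matrix.mul_nonsing_inv _ (isUnit_iff_ne_zero.2 (hE k))

theorem isTail_cinv {s : ℕ} {E : CMat N p p} (h : IsTail s E) (hE : ∀ k, (E k).det ≠ 0) :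
    IsTail s (cinv E hE) := fun k' k => by
  simp [cinv, h k' k]

/-! ### The elimination scheme -/

theorem IsUnit.exists_bounded_below {T : L2 N M →L[ℂ] L2 N M} (hT : IsUnit T) :
    ∃ c : ℝ, 0 < c ∧ ∀ u, c * ‖u‖ ≤ ‖T u‖ := by
  obtain ⟨S, hS⟩ := hT.exists_left_inv
  have hpos : 0 < ‖S‖ + 1 := by positivity
  refine ⟨(‖S‖ + 1)⁻¹, inv_pos.2 hpos, fun u => ?_⟩
  rw [inv_mul_le_iff₀ hpos]
  calc ‖u‖ = ‖S (T u)‖ := by rw [← mul_apply_eq_comp, hS]; rfl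
    _ ≤ ‖S‖ * ‖T u‖ := S.le_opNorm _
    _ ≤ _ := mul_le_mul_of_nonneg_right (by linarith) (norm_nonneg _)

theorem exists_bounded_below_of_mul {P g : L2 N M →L[ℂ] L2 N M} {c : ℝ} (hc : 0 < c)
    (h : ∀ u, c * ‖u‖ ≤ ‖(P * g) u‖) : ∃ c' : ℝ, 0 < c' ∧ ∀ u, c' * ‖u‖ ≤ ‖g u‖ := by
  have hpos : 0 < ‖P‖ + 1 := by positivity
  refine ⟨c / (‖P‖ + 1), by positivity, fun u => ?_⟩
  rw [div_mul_eq_mul_div, div_le_iff₀ hpos]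
  calc c * ‖u‖ ≤ ‖P (g u)‖ := h u
    _ ≤ ‖P‖ * ‖g u‖ := P.le_opNorm _
    _ ≤ ‖g u‖ * (‖P‖ + 1) := by linarith [norm_nonneg (g u)]

/-- The Woodbury formula; it applies because `𝐄⁻¹`, like `𝐄`, does not depend on the averaged
variables. -/
theorem sandwich_inverse {s : ℕ} (A : CMat N M m) (B : CMat N m M)
    (hE : ∀ k, ((oneMat m + avgC s (B ⊡ A) : CMat N m m) k).det ≠ 0) :
    (1 - sandwich s (A ⊡ cinv _ hE) B) * (1 + sandwich s A B) = 1 ∧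
      (1 + sandwich s A B) * (1 - sandwich s (A ⊡ cinv _ hE) B) = 1 := by
  have h₁ := cinv_cmul _ hE
  have h₂ := cmul_cinv _ hE
  have hE' : IsTail s (cinv _ hE) :=
    isTail_cinv ((isTail_const s _).add (isTail_avgC le_rfl _)) hE
  set G := cinv _ hE
  rw [cmul_add, cmul_oneMat] at h₁
  rw [add_cmul, oneMat_cmul] at h₂
  constructor
  · have h : A ⊡ G + A ⊡ G ⊡ avgC s (B ⊡ A) = A := by
      rw [cmul_assoc, ← cmul_add, h₁, cmul_oneMat]
    rw [mul_add, sub_mul, sub_mul, sandwich_mul_sandwich_of_le le_rfl, mul_one, mul_one, one_mul]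
    have h' := sandwich_add_left s (A ⊡ G) (A ⊡ G ⊡ avgC s (B ⊡ A)) B
    rw [h] at h'
    rw [h']
    abel
  · have h : A ⊡ G + A ⊡ avgC s (B ⊡ (A ⊡ G)) = A := by
      rw [← cmul_assoc B, avgC_cmul_of_isTail_right s _ hE', ← cmul_add, h₂, cmul_oneMat]
    rw [mul_sub, add_mul, add_mul, sandwich_mul_sandwich_of_le le_rfl, mul_one, mul_one, one_mul]
    have h' := sandwich_add_left s (A ⊡ G) (A ⊡ avgC s (B ⊡ (A ⊡ G))) B
    rw [h] at h'
    rw [h']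
    abel

namespace Rep

/-- The part `𝐀_0· + 𝐀_1⟨𝐁_1·⟩_1 + … + 𝐀_s⟨𝐁_s·⟩_s` of the operator. -/
def trunc (R : Rep N M) (s : ℕ) : L2 N M →L[ℂ] L2 N M :=
  mulOp R.A₀ + ∑ r : Fin N with r.1 < s, sandwich (r.1 + 1) (R.A r) (R.B r)

theorem isTrunc (R : Rep N M) (s : ℕ) : IsTrunc s R.toOp (R.trunc s) := by
  rw [toOp, trunc, Finset.sum_filter]
  refine (isTrunc_mulOp s _).add (IsTrunc.sum _ fun r _ => ?_)
  split_ifs with h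
  · exact isTrunc_sandwich_of_le h _ _
  · exact isTrunc_sandwich_of_lt (by omega) (by omega) _ _

theorem trunc_zero (R : Rep N M) : R.trunc 0 = mulOp R.A₀ := by
  simp [trunc]

theorem trunc_self (R : Rep N M) : R.trunc N = R.toOp := by
  simp [trunc, toOp]

theorem trunc_succ (R : Rep N M) {s : ℕ} (h : s < N) : R.trunc (s + 1) =
    R.trunc s + sandwich (s + 1) (R.A ⟨s, h⟩) (R.B ⟨s, h⟩) := by
  have hf : (Finset.univ.filter fun r : Fin N => r.1 < s + 1) =
      insert ⟨s, h⟩ (Finset.univ.filter fun r : Fin N => r.1 < s) := by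
    ext r
    simp only [Finset.mem_filter, Finset.mem_univ, true_and, Finset.mem_insert, Fin.ext_iff]
    omega
  rw [trunc, trunc, hf, Finset.sum_insert (by simp)]
  abel

theorem trunc_mem_filt (R : Rep N M) (s : ℕ) : R.trunc s ∈ filt N M s :=
  add_mem (mulOp_mem_filt s _) (sum_mem fun _ hr =>
    sandwich_mem_filt (Nat.succ_le_of_lt (Finset.mem_filter.1 hr).2) _ _)

theorem trunc_bounded_below (R : Rep N M) {c : ℝ} (h : ∀ u, c * ‖u‖ ≤ ‖R.toOp u‖) (s : ℕ)
    (u : L2 N M) : c * ‖u‖ ≤ ‖R.trunc s u‖ :=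
  (R.isTrunc s).bounded_below h u

theorem det_A₀_ne_zero (R : Rep N M) {c : ℝ} (hc : 0 < c) (h : ∀ u, c * ‖u‖ ≤ ‖R.toOp u‖)
    (k : Cube N) : (R.A₀ k).det ≠ 0 := by
  refine det_ne_zero_of_bounded_below (isTail_zero _) hc (fun u => ?_) k
  rw [← R.trunc_zero]
  exact R.trunc_bounded_below h 0 _

/-- The result of the first `s` steps of the scheme: `V` is the inverse of the truncated operator
and the `𝐀_{r+1,s}` are the functions `V 𝐀_{r+1}`. -/
structure Step (R : Rep N M) (s : ℕ) (V : L2 N M →L[ℂ] L2 N M) : Prop where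
  mem : V ∈ filt N M s
  left_inv : V * R.trunc s = 1
  right_inv : R.trunc s * V = 1
  elim : ∀ r : Fin N, s ≤ r.1 → ∃ C : CMat N M (R.m r), ⇑C = R.elim s r ∧
    ∀ u, V (mulOp (R.A r) (avgOp (r.1 + 1) u)) = mulOp C (avgOp (r.1 + 1) u)

theorem Step.exists_quotient {R : Rep N M} {s : ℕ} {V : L2 N M →L[ℂ] L2 N M} (hV : R.Step s V)
    (h : s < N) : ∃ C : CMat N M (R.m ⟨s, h⟩), ⇑C = R.elim s ⟨s, h⟩ ∧
      V * R.trunc (s + 1) = 1 + sandwich (s + 1) C (R.B ⟨s, h⟩) := by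
  obtain ⟨C, hC, hVC⟩ := hV.elim ⟨s, h⟩ le_rfl
  refine ⟨C, hC, ?_⟩
  rw [R.trunc_succ h, mul_add, hV.left_inv]
  congr 1
  exact ContinuousLinearMap.ext fun u => hVC _

theorem Step.trunc_succ_eq {R : Rep N M} {s : ℕ} {V g : L2 N M →L[ℂ] L2 N M} (hV : R.Step s V)
    (hg : V * R.trunc (s + 1) = g) : R.trunc (s + 1) = R.trunc s * g := by
  rw [← hg, ← mul_assoc, hV.right_inv, one_mul]

theorem exists_step (R : Rep N M) {c : ℝ} (hc : 0 < c) (h : ∀ u, c * ‖u‖ ≤ ‖R.toOp u‖) (s : ℕ)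
    (hs : s ≤ N) : ∃ V, R.Step s V := by
  induction s with
  | zero =>
    have hdet := R.det_A₀_ne_zero hc h
    refine ⟨mulOp (cinv R.A₀ hdet), mulOp_mem_filt 0 _, ?_, ?_, fun r _ => ?_⟩
    · rw [trunc_zero]
      exact ContinuousLinearMap.ext fun u => by
        rw [mul_apply_eq_comp, mulOp_mulOp, cinv_cmul, mulOp_oneMat]; rfl
    · rw [trunc_zero]
      exact ContinuousLinearMap.ext fun u => by
        rw [mul_apply_eq_comp, mulOp_mulOp, cmul_cinv, mulOp_oneMat]; rfl
    · exact ⟨cinv R.A₀ hdet ⊡ R.A r, rfl, fun u => mulOp_mulOp _ _ _⟩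
  | succ s ih =>
    obtain ⟨V, hV⟩ := ih (Nat.le_of_succ_le hs)
    obtain ⟨C, hC, hg⟩ := hV.exists_quotient hs
    have hP := hV.trunc_succ_eq hg
    -- Only lower bounds survive the strong limit, not invertibility. The lower bound of `T_{s+1} =
    -- T_s g` passes to the right factor `g`, and that is enough to invert `𝐄` pointwise, hence `g`.
    obtain ⟨c', hc', hbb⟩ := exists_bounded_below_of_mul hc
      (hP ▸ R.trunc_bounded_below h (s + 1))
    have hE : ∀ k, ((oneMat _ + avgC (s + 1) (R.B ⟨s, hs⟩ ⊡ C) :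
        CMat N (R.m ⟨s, hs⟩) (R.m ⟨s, hs⟩)) k).det ≠ 0 :=
      det_ne_zero_of_sandwich hc' hbb
    obtain ⟨hl, hr⟩ := sandwich_inverse C (R.B ⟨s, hs⟩) hE
    -- The new inverse is `g⁻¹V`. Applying `g⁻¹` to `V𝐀_j = 𝐀_{j,s}` is exactly the recursion
    -- defining `𝐀_{j,s+1}`.
    refine ⟨(1 - sandwich (s + 1) (C ⊡ cinv _ hE) (R.B ⟨s, hs⟩)) * V,
      mul_mem_filt (sub_mem (one_mem_filt _) (sandwich_mem_filt le_rfl _ _))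
        (filt_mono s.le_succ hV.mem), ?_, ?_, fun r hr => ?_⟩
    · rw [mul_assoc, hg, hl]
    · rw [hP, mul_assoc, ← mul_assoc _ _ V, hr, one_mul, hV.right_inv]
    · obtain ⟨D, hD, hVD⟩ := hV.elim r (Nat.le_of_succ_le hr)
      refine ⟨D - C ⊡ cinv _ hE ⊡ avgC (s + 1) (R.B ⟨s, hs⟩ ⊡ D), ?_, fun u => ?_⟩
      · funext k
        rw [Rep.elim, dif_pos (show s < N from hs), ← hC, ← hD]
        rfl
      · rw [mul_apply_eq_comp, hVD, sub_apply, sandwich_apply, mulOp_mulOp _ D,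
          avgOp_mulOp_avgOp_of_le (by omega), mulOp_mulOp, mulOp_sub, sub_apply]
        rfl

theorem piFun_succ (R : Rep N M) {s : ℕ} (h : s < N) {C : CMat N M (R.m ⟨s, h⟩)}
    (hC : ⇑C = R.elim s ⟨s, h⟩) (k : Cube N) :
    R.piFun ⟨s + 1, Nat.succ_lt_succ h⟩ (tail (s + 1) k) =
      (1 + avgC (s + 1) (R.B ⟨s, h⟩ ⊡ C) k).det := by
  simp only [piFun, E, ← hC]
  rfl

theorem Step.isDet {R : Rep N M} {s : ℕ} {V : L2 N M →L[ℂ] L2 N M} (hV : R.Step s V)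
    (h : s < N) : IsDet (s + 1) (V * R.trunc (s + 1))
      fun k => R.piFun ⟨s + 1, Nat.succ_lt_succ h⟩ (tail (s + 1) k) := by
  obtain ⟨C, hC, hg⟩ := hV.exists_quotient h
  exact ⟨_, C, R.B ⟨s, h⟩, hg, R.piFun_succ h hC⟩

theorem piFun_zero (R : Rep N M) (h : 0 < N + 1) (k : Cube N) :
    R.piFun ⟨0, h⟩ (tail 0 k) = (R.A₀ k).det := rfl

theorem piFun_ne_zero (R : Rep N M) (hR : IsUnit R.toOp) (j : Fin (N + 1)) (y : Tail N j.1) :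
    R.piFun j y ≠ 0 := by
  obtain ⟨c, hc, h⟩ := IsUnit.exists_bounded_below hR
  obtain ⟨k, rfl⟩ := tail_surjective j.1 y
  obtain ⟨_ | s, hj⟩ := j
  · exact R.det_A₀_ne_zero hc h k
  · have hs : s < N := Nat.lt_of_succ_lt_succ hj
    obtain ⟨V, hV⟩ := R.exists_step hc h s hs.le
    obtain ⟨C, hC, hg⟩ := hV.exists_quotient hs
    obtain ⟨c', hc', hbb⟩ := exists_bounded_below_of_mul hc
      (hV.trunc_succ_eq hg ▸ R.trunc_bounded_below h (s + 1))
    rw [R.piFun_succ hs hC]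
    exact det_ne_zero_of_sandwich hc' hbb k

theorem continuous_piFun (R : Rep N M) (hR : IsUnit R.toOp) (j : Fin (N + 1)) :
    Continuous (R.piFun j) := by
  obtain ⟨c, hc, h⟩ := IsUnit.exists_bounded_below hR
  obtain ⟨_ | s, hj⟩ := j
  · have hcont : Continuous fun (y : Tail N 0) (i : Fin N) => y ⟨i, Nat.not_lt_zero i.1⟩ := by
      fun_prop
    exact (R.A₀.continuous.comp hcont).matrix_det
  · have hs : s < N := Nat.lt_of_succ_lt_succ hj
    obtain ⟨V, hV⟩ := R.exists_step hc h s hs.le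
    obtain ⟨C, hC, hg⟩ := hV.exists_quotient hs
    have h1 : R.piFun ⟨s + 1, hj⟩ = fun y => (1 + avgT (s + 1) (R.B ⟨s, hs⟩ ⊡ C) y).det := by
      funext y
      simp only [piFun, E, ← hC]
      rfl
    rw [h1]
    exact (continuous_const.add (avgT (s + 1) _).continuous).matrix_det

theorem exists_inverse (R : Rep N M) (hR : IsUnit R.toOp) :
    ∃ V ∈ filt N M N, V * R.toOp = 1 ∧ R.toOp * V = 1 := by
  obtain ⟨c, hc, h⟩ := IsUnit.exists_bounded_below hR
  obtain ⟨V, hV⟩ := R.exists_step hc h N le_rfl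
  exact ⟨V, hV.mem, R.trunc_self ▸ hV.left_inv, R.trunc_self ▸ hV.right_inv⟩

/-- With `T'' = TT'`, and `g, g', g''` the quotients `T_s⁻¹T_{s+1}` of the three operators,
multiplicativity of truncation gives `g'' = (T'_s⁻¹ g T'_s) g'`. The representation of the product
is arbitrary, so independence of the representation is also contained here. -/
theorem piFun_mul {R R' R'' : Rep N M} (hR : IsUnit R.toOp) (hR' : IsUnit R'.toOp)
    (h : R''.toOp = R.toOp * R'.toOp) (j : Fin (N + 1)) (y : Tail N j.1) :
    R''.piFun j y = R.piFun j y * R'.piFun j y := by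
  have htr : ∀ s, R''.trunc s = R.trunc s * R'.trunc s := fun s =>
    (R''.isTrunc s).unique (h ▸ (R.isTrunc s).mul (R'.isTrunc s))
  obtain ⟨c, hc, hb⟩ := IsUnit.exists_bounded_below hR
  obtain ⟨c', hc', hb'⟩ := IsUnit.exists_bounded_below hR'
  obtain ⟨c'', hc'', hb''⟩ := IsUnit.exists_bounded_below (h ▸ hR.mul hR')
  obtain ⟨k, rfl⟩ := tail_surjective j.1 y
  obtain ⟨_ | s, hj⟩ := j
  · have h0 := htr 0
    rw [trunc_zero, trunc_zero, trunc_zero] at h0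
    have h1 : R''.A₀ = R.A₀ ⊡ R'.A₀ := mulOp_injective <| h0.trans <|
      ContinuousLinearMap.ext fun u => mulOp_mulOp _ _ u
    exact (congrArg Matrix.det (DFunLike.congr_fun h1 k)).trans (Matrix.det_mul _ _)
  · have hs : s < N := Nat.lt_of_succ_lt_succ hj
    obtain ⟨V, hV⟩ := R.exists_step hc hb s hs.le
    obtain ⟨V', hV'⟩ := R'.exists_step hc' hb' s hs.le
    obtain ⟨V'', hV''⟩ := R''.exists_step hc'' hb'' s hs.le
    have hinv : V'' = V' * V := by
      refine left_inv_eq_right_inv hV''.left_inv ?_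
      rw [htr, mul_assoc, ← mul_assoc _ V' V, hV'.right_inv, one_mul, hV.right_inv]
    have hg : V'' * R''.trunc (s + 1) =
        V' * (V * R.trunc (s + 1)) * R'.trunc s * (V' * R'.trunc (s + 1)) := by
      rw [hinv, htr]
      simp only [mul_assoc]
      rw [← mul_assoc (R'.trunc s) V', hV'.right_inv, one_mul]
    have hd := ((hV.isDet hs).conj s.le_succ (R'.trunc_mem_filt s) hV'.mem hV'.left_inv
      hV'.right_inv).mul (hV'.isDet hs)
    rw [← hg] at hd
    exact congrFun ((hV''.isDet hs).unique hd) k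

/-- A step of the scheme which does not change the truncated operator has `π_{s+1} = 1`. -/
theorem piFun_eq_one {R : Rep N M} (hR : IsUnit R.toOp) {s : ℕ} (h : s < N)
    (heq : R.trunc (s + 1) = R.trunc s) (y : Tail N (s + 1)) :
    R.piFun ⟨s + 1, Nat.succ_lt_succ h⟩ y = 1 := by
  obtain ⟨c, hc, hb⟩ := IsUnit.exists_bounded_below hR
  obtain ⟨k, rfl⟩ := tail_surjective (s + 1) y
  obtain ⟨V, hV⟩ := R.exists_step hc hb s h.le
  have h1 := hV.isDet h
  rw [heq, hV.left_inv] at h1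
  exact congrFun (h1.unique (IsDet.one _)) k

theorem piFun_zero_eq_one {R : Rep N M} (heq : R.trunc 0 = 1) (h : 0 < N + 1) (y : Tail N 0) :
    R.piFun ⟨0, h⟩ y = 1 := by
  obtain ⟨k, rfl⟩ := tail_surjective 0 y
  rw [trunc_zero, one_eq_mulOp] at heq
  rw [piFun_zero, mulOp_injective heq]
  simp

theorem piFun_one {R : Rep N M} (hR : R.toOp = 1) (j : Fin (N + 1)) (y : Tail N j.1) :
    R.piFun j y = 1 := by
  have htr : ∀ s, R.trunc s = 1 := fun s => (R.isTrunc s).unique (hR ▸ isTrunc_one s)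
  obtain ⟨_ | s, hj⟩ := j
  · exact piFun_zero_eq_one (htr 0) hj y
  · exact piFun_eq_one (hR ▸ isUnit_one) (Nat.lt_of_succ_lt_succ hj) (by rw [htr, htr]) y

theorem piFun_eq_one_of_mem_F {R : Rep N M} {j : Fin (N + 1)} (hR : R.toOp ∈ F N M j)
    {i : Fin (N + 1)} (hij : i ≠ j) (y : Tail N i.1) : R.piFun i y = 1 := by
  obtain ⟨hU, ⟨hj, A, hA⟩ | ⟨hj, m, -, A, B, hAB⟩⟩ := hR
  · have htr : ∀ s, R.trunc s = mulOp A := fun s =>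
      (R.isTrunc s).unique (hA ▸ isTrunc_mulOp s A)
    obtain ⟨_ | s, hi⟩ := i
    · exact absurd (Fin.ext hj.symm) hij
    · exact piFun_eq_one hU (Nat.lt_of_succ_lt_succ hi) (by rw [htr, htr]) y
  -- `R` is an arbitrary representation and need not have the single term of `hAB`; uniqueness of
  -- the strong limit still determines all its truncations.
  · have hlt : ∀ s < j.1, R.trunc s = 1 := fun s hs => (R.isTrunc s).unique (by
      have := (isTrunc_one s).add (isTrunc_sandwich_of_lt hs (by omega) A B)
      rwa [add_zero, ← hAB] at this)
    have hle : ∀ s, j.1 ≤ s → R.trunc s = R.toOp := fun s hs => (R.isTrunc s).unique (by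
      have := (isTrunc_one s).add (isTrunc_sandwich_of_le hs A B)
      rwa [← hAB] at this)
    obtain ⟨_ | s, hi⟩ := i
    · exact piFun_zero_eq_one (hlt 0 hj) hi y
    · refine piFun_eq_one hU (Nat.lt_of_succ_lt_succ hi) ?_ y
      have hne : s + 1 ≠ j.1 := fun h => hij (Fin.ext h)
      rcases lt_or_ge (s + 1) j.1 with h | h
      · rw [hlt _ h, hlt _ (by omega)]
      · rw [hle _ h, hle _ (by omega)]

end Rep

/-! ### The homomorphism -/

theorem exists_rep {T : L2 N M →L[ℂ] L2 N M} (hT : T ∈ H N M) : ∃ R : Rep N M, R.toOp = T :=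
  exists_rep_of_mem_filt (H_subset_filt hT)

theorem exists_unit {T : L2 N M →L[ℂ] L2 N M} (hT : T ∈ H N M) (hU : IsUnit T) :
    ∃ u : (H N M)ˣ, ((u : H N M) : L2 N M →L[ℂ] L2 N M) = T := by
  obtain ⟨R, rfl⟩ := exists_rep hT
  obtain ⟨V, hV, hl, hr⟩ := R.exists_inverse hU
  exact ⟨⟨⟨_, hT⟩, ⟨V, filt_subset_H hV⟩, Subtype.ext hr, Subtype.ext hl⟩, rfl⟩

theorem isUnit_coe (u : (H N M)ˣ) : IsUnit ((u : H N M) : L2 N M →L[ℂ] L2 N M) :=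
  u.isUnit.map (H N M).val

theorem F_subset_H {j : Fin (N + 1)} {T : L2 N M →L[ℂ] L2 N M} (hT : T ∈ F N M j) :
    T ∈ H N M := by
  obtain ⟨-, ⟨-, A, rfl⟩ | ⟨-, m, -, A, B, rfl⟩⟩ := hT
  · exact filt_subset_H (mulOp_mem_filt N A)
  · exact filt_subset_H (add_mem (one_mem_filt N)
      (sandwich_mem_filt (Nat.le_of_lt_succ j.2) A B))

/-- A chosen representation of an invertible element of the algebra. -/
def repOf (u : (H N M)ˣ) : Rep N M := (exists_rep (u : H N M).2).choose

theorem toOp_repOf (u : (H N M)ˣ) :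
    (repOf u).toOp = ((u : H N M) : L2 N M →L[ℂ] L2 N M) :=
  (exists_rep (u : H N M).2).choose_spec

theorem isUnit_toOp_repOf (u : (H N M)ˣ) : IsUnit (repOf u).toOp :=
  toOp_repOf u ▸ isUnit_coe u

/-- The tuple `(π_0, …, π_N)` of an invertible element of the algebra. -/
def piTuple (u : (H N M)ˣ) : CAlg N := fun j =>
  ⟨(repOf u).piFun j, (repOf u).continuous_piFun (isUnit_toOp_repOf u) j⟩

theorem isUnit_piTuple (u : (H N M)ˣ) : IsUnit (piTuple u) :=
  Pi.isUnit_iff.2 fun j => (ContinuousMap.isUnit_iff_forall_ne_zero _).2 fun y =>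
    (repOf u).piFun_ne_zero (isUnit_toOp_repOf u) j y

theorem piTuple_mul (u v : (H N M)ˣ) : piTuple (u * v) = piTuple u * piTuple v := by
  funext j
  ext y
  refine Rep.piFun_mul (isUnit_toOp_repOf u) (isUnit_toOp_repOf v) ?_ j y
  rw [toOp_repOf, toOp_repOf, toOp_repOf]
  rfl

/-- The chosen representation of `u` represents the product of `R` and a representation of the
identity, whose components are all `1`. -/
theorem piTuple_apply (u : (H N M)ˣ) {R : Rep N M}
    (hR : R.toOp = ((u : H N M) : L2 N M →L[ℂ] L2 N M)) (j : Fin (N + 1)) (y : Tail N j.1) :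
    piTuple u j y = R.piFun j y := by
  have h1 : (repOf (1 : (H N M)ˣ)).toOp = 1 := toOp_repOf 1
  have h := Rep.piFun_mul (R := R) (R'' := repOf u) (hR ▸ isUnit_coe u)
    (isUnit_toOp_repOf 1) (by rw [toOp_repOf, h1, hR, mul_one]) j y
  rwa [Rep.piFun_one h1, mul_one] at h

/-- The homomorphism `π`. -/
def piHom (N M : ℕ) : (H N M)ˣ →* (CAlg N)ˣ :=
  MonoidHom.mk' (fun u => (isUnit_piTuple u).unit) fun u v => Units.ext (piTuple_mul u v)

end

end PeriodicOp

theorem theorem4 (N M : ℕ) :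
    -- every operator of the algebra has a representation, to which the scheme applies
    (∀ T ∈ PeriodicOp.H N M, ∃ R : PeriodicOp.Rep N M, R.toOp = T) ∧
    -- the inverse of an invertible operator of the algebra is in the algebra
    (∀ T ∈ PeriodicOp.H N M, IsUnit T →
      ∃ u : (PeriodicOp.H N M)ˣ, ((u : PeriodicOp.H N M) : _ →L[ℂ] _) = T) ∧
    -- `π`, computed by the scheme from any representation, is a group homomorphism
    ∃ π : (PeriodicOp.H N M)ˣ →* (PeriodicOp.CAlg N)ˣ,
      (∀ (u : (PeriodicOp.H N M)ˣ) (R : PeriodicOp.Rep N M),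
        R.toOp = ((u : PeriodicOp.H N M) : _ →L[ℂ] _) →
          ∀ (j : Fin (N + 1)) (y : PeriodicOp.Tail N j.1),
            (π u : PeriodicOp.CAlg N) j y = R.piFun j y) ∧
      -- on `𝓕_j` all components of `π` but the `j`-th are `1`
      ∀ j : Fin (N + 1), ∀ T ∈ PeriodicOp.F N M j,
        ∃ u : (PeriodicOp.H N M)ˣ, ((u : PeriodicOp.H N M) : _ →L[ℂ] _) = T ∧
          ∀ i : Fin (N + 1), i ≠ j → (π u : PeriodicOp.CAlg N) i = 1 := by
  refine ⟨fun _ => PeriodicOp.exists_rep, fun _ => PeriodicOp.exists_unit,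
    PeriodicOp.piHom N M, fun u _ hR => PeriodicOp.piTuple_apply u hR, fun j T hT => ?_⟩
  obtain ⟨u, rfl⟩ := PeriodicOp.exists_unit (PeriodicOp.F_subset_H hT) hT.1
  refine ⟨u, rfl, fun i hij => ContinuousMap.ext fun y => ?_⟩
  exact PeriodicOp.Rep.piFun_eq_one_of_mem_F ((PeriodicOp.toOp_repOf u).symm ▸ hT) hij y
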